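/- Throughout, graphs are finite and simple, with nonempty vertex set, and not necessarily connected. For a graph $G$ and $k\ge 3$ let $d_k(G)=c_k(G)/|V(G)|$, where $c_k(G)$ is the number of $k$-cycles of $G$ (that is, subgraphs of $G$ isomorphic to the cycle of length $k$), and put $P(G)=(d_3(G),d_4(G))\in\mathbb R^2$. Fix an integer $r\ge 3$ and let $$\mathcal P^r=\{P(G): G \text{ is an } r\text{-regular graph}\}.$$ A Berge cycle of length $k\ge 2$ in a hypergraph consists of distinct vertices $x_0,\dots,x_{k-1}$ and distinct hyperedges $E_0,\dots,E_{k-1}$ with $x_j,x_{j+1}\in E_j$ for all $j$ (indices modulo $k$). For $1\le l\le r$ let $C^r_l$ denote any graph obtained as follows. Put $r_i=\lfloor (r+i-1)/l\rfloor$ for $1\le i\le l$. Take a finite hypergraph $H$ with nonempty vertex set in which each vertex lies in exactly $l$ hyperedges, of sizes $r_1+1,\dots,r_l+1$, and in which every Berge cycle has length at least $5$; the vertices of $C^r_l$ are those of $H$, and two distinct vertices are adjacent iff some hyperedge of $H$ contains both. **Theorem.** For every $1\le l\le r$ such a graph $C^r_l$ exists, and the point $P(C^r_l)$ does not depend on the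 choice of $H$. Let $$\mathcal Q^r=\operatorname{conv}\{P(K_{r,r}),P(C^r_1),\dots,P(C^r_r)\}\subset\mathbb R^2 .$$ Then $$\mathcal P^r=\{(x,y)\in\mathcal Q^r : x,y\in\mathbb Q\},$$ and the closure of $\mathcal P^r$ equals $\mathcal Q^r$. Moreover, let $L_r=\{\lfloor r/q\rfloor,\lceil r/q\rceil : q=1,\dots,r\}$. The vertices (extreme points) of $\mathcal Q^r$ are exactly $P(K_{r,r})$ and the points $P(C^r_l)$ with $l\in L_r$; their number is $|L_r|+1$, which is at most $\lceil r/2\rceil+2$. -/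

import Mathlib

namespace CycleDensity

noncomputable section

/-- The density `d_k(G)`: the number of `k`-cycles of `G` (subgraphs of `G` isomorphic to the cycle
of length `k`, meaningful for `3 ≤ k`), divided by the number of vertices. -/
def density {V : Type*} [Fintype V] (k : ℕ) (G : SimpleGraph V) : ℝ :=
  (G.copyCount (SimpleGraph.cycleGraph k) : ℝ) / (Fintype.card V : ℝ)

/-- The point `P(G) = (d_3(G), d_4(G))` of the plane. -/
def point {V : Type*} [Fintype V] (G : SimpleGraph V) : ℝ × ℝ :=
  (density 3 G, density 4 G)

/-- The set of all points `P(G)`, where `G` runs over the (nonempty, not necessarily connected)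
finite simple `r`-regular graphs. -/
def regularPoints (r : ℕ) : Set (ℝ × ℝ) :=
  {p | ∃ (V : Type) (_ : Fintype V) (_ : Nonempty V) (G : SimpleGraph V) (_ : DecidableRel G.Adj),
    G.IsRegularOfDegree r ∧ point G = p}

/-- The hypergraph `H` has a Berge cycle of length `k`: there are `k ≥ 2` distinct vertices and
`k` distinct hyperedges, both cyclically indexed, such that the `j`-th hyperedge contains the
`j`-th and the `(j+1)`-st vertex. -/
def HasBergeCycle {V : Type*} (H : Hypergraph V) (k : ℕ) : Prop :=
  2 ≤ k ∧ ∃ (x : ZMod k → V) (e : ZMod k → Set V),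
    Function.Injective x ∧ Function.Injective e ∧
      ∀ j, e j ∈ H.edgeSet ∧ x j ∈ e j ∧ x (j + 1) ∈ e j

/-- Each vertex lies in exactly `l` hyperedges of `H`, and the sizes of these hyperedges are
`s 0, …, s (l - 1)` in some order. -/
def HasEdgeSizes {V : Type*} (H : Hypergraph V) {l : ℕ} (s : Fin l → ℕ) : Prop :=
  ∀ x : V, ∃ e : Fin l → Set V, Function.Injective e ∧
    Set.range e = {E | E ∈ H.edgeSet ∧ x ∈ E} ∧ ∀ i, (e i).ncard = s i

/-- `G` is one of the graphs `G_{r_1,…,r_l}`: there is a hypergraph `H` on the vertex set of `G`,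
of girth at least `5`, such that the hyperedges at each vertex have sizes `r_1 + 1, …, r_l + 1`,
and two distinct vertices are adjacent in `G` iff some hyperedge of `H` contains both. -/
def IsHypergraphSection {V : Type*} {l : ℕ} (s : Fin l → ℕ) (G : SimpleGraph V) : Prop :=
  ∃ H : Hypergraph V, H.vertexSet = Set.univ ∧ HasEdgeSizes H (fun i => s i + 1) ∧
    (∀ k, HasBergeCycle H k → 5 ≤ k) ∧ G = SimpleGraph.fromRel H.Adj

/-- The partition of `r` into `l` parts that are as equal as possible:
`⌊r / l⌋, ⌊(r + 1) / l⌋, …, ⌊(r + l - 1) / l⌋`. -/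
def equalParts (r l : ℕ) (i : Fin l) : ℕ := (r + i) / l

/-- The points `P(G)` of all finite graphs `G` that are obtained by the construction of `C^r_l`
(it is part of the theorem that there is exactly one such point). -/
def extremeGraphPoints (r l : ℕ) : Set (ℝ × ℝ) :=
  {p | ∃ (V : Type) (_ : Fintype V) (_ : Nonempty V) (G : SimpleGraph V),
    IsHypergraphSection (equalParts r l) G ∧ point G = p}

/-- The point of the complete bipartite graph `K_{r,r}`. -/
def bipartitePoint (r : ℕ) : ℝ × ℝ :=
  point (completeBipartiteGraph (Fin r) (Fin r))

/-- The polygon `Q^r`: the convex hull of the points of `K_{r,r}` and of `C^r_1, …, C^r_r`. -/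
def polygon (r : ℕ) : Set (ℝ × ℝ) :=
  convexHull ℝ ({bipartitePoint r} ∪ ⋃ l ∈ Finset.Icc 1 r, extremeGraphPoints r l)

/-- The indices `l` of the form `⌊r / q⌋` or `⌈r / q⌉` with `1 ≤ q ≤ r`. -/
def vertexIndices (r : ℕ) : Finset ℕ :=
  (Finset.Icc 1 r).image (fun q => r / q) ∪ (Finset.Icc 1 r).image (fun q => r ⌈/⌉ q)

end

end CycleDensity

/-! Cycle counts become sums over labelled closed walks: with `n` vertices, `tri = 6 n d_3` and
`quad = 8 n d_4`. Disjoint unions of copies realise all rational convex combinations of realised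
points, so what matters is that the generators are realised, that no regular graph leaves their
hull, and that rational points of the hull are rational combinations of generators.

Upper side: for each path `b - a - d`, the common neighbours of `b` and `d`, plus one if `b` and `d`
are adjacent, number at most `r`. Summing gives `quad + tri ≤ n r (r-1)^2`, a line through the
points of `K_{r,r}` and of `C^r_1`, which is a disjoint union of copies of `K_{r+1}`.

Lower side: only the four-cycles with a chord are kept. They are counted inside neighbourhoods, and
a linear combination of `quad` and `tri` is bounded below by a sum over vertices of an `energy` of
the neighbourhood indicator (`le_quad_sub_tri`). The energy is a cubic minus a multiple of a
quadratic form in vertex weights, minimised over integer weights of total `r` by a Motzkin–Straus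
argument. Moving weight along an edge is concave, so merging adjacent weights costs nothing and the
support may be taken independent. The energy is then a sum over single weights, and exchanging or
merging weights makes them differ by at most one (`exists_partition_le_energy`). So the minimum is
attained by an almost equal partition of `r`, which is what `C^r_l` realises. A separating
functional then puts every point in the polygon.

The graphs `C^r_l` come from a finite group with subgroups `Z/(r_i+1)` in which short reduced words
are nontrivial: the cosets are the hyperedges (`exists_isHypergraphSection`). Girth at least five
confines triangles and four-cycles to single hyperedges, so the counts depend on the part sizes
alone.

For the vertices of the polygon, `n (n-q) (n-q-1) ≥ 0` on naturals gives for each `q` a supporting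
line touching exactly those `C^r_l` whose parts are all `q` or `q+1`, that is `r/(q+1) ≤ l ≤ r/q`.
On it the points are affine in `l`, so only the extreme integers `⌈r/(q+1)⌉` and `⌊r/q⌋` survive. -/

namespace CycleDensity

open Finset

/-! ### Cycle densities as labelled counts -/

section Counting

variable {V W : Type*}

/-- The number of labelled copies is the number of unlabelled ones times the number of
automorphisms. -/
theorem card_copy_eq_copyCount_mul [Fintype V] [Fintype W] (G : SimpleGraph V)
    (H : SimpleGraph W) :
    Nat.card (SimpleGraph.Copy H G) = G.copyCount H * Nat.card (H ≃g H) := by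
  classical
  have : Fintype (SimpleGraph.Copy H G) := Fintype.ofFinite _
  rw [SimpleGraph.copyCount_eq_card_image_copyToSubgraph, Nat.card_eq_fintype_card,
    ← Finset.card_univ]
  have huniv : (Finset.univ : Finset (SimpleGraph.Copy H G)) =
      @Finset.univ _ SimpleGraph.Copy.instFintypeOfSubtypeHomInjectiveCoe := by
    ext; simp
  rw [← huniv]
  rw [Finset.card_eq_sum_card_image SimpleGraph.Copy.toSubgraph, Finset.sum_const_nat]
  intro S hS
  obtain ⟨f₀, -, rfl⟩ := Finset.mem_image.1 hS
  rw [← Fintype.card_subtype, ← Nat.card_eq_fintype_card]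
  symm
  -- Copies with the same image subgraph differ by a unique automorphism of `H`, so each fibre is a
  -- torsor under the automorphism group.
  refine Nat.card_congr (Equiv.ofBijective (fun σ : H ≃g H =>
    (⟨f₀.comp σ.toCopy, ?_⟩ : {f : SimpleGraph.Copy H G // f.toSubgraph = f₀.toSubgraph})) ⟨?_, ?_⟩)
  · ext x y
    · simp only [SimpleGraph.Copy.toSubgraph, SimpleGraph.Subgraph.map_verts,
        SimpleGraph.Subgraph.verts_top, Set.image_univ, Set.mem_range]
      exact ⟨fun ⟨y, h⟩ => ⟨σ y, h⟩, fun ⟨y, h⟩ => ⟨σ.symm y, by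
        rw [← h]; exact congrArg f₀ (σ.apply_symm_apply y)⟩⟩
    · simp only [SimpleGraph.Copy.toSubgraph, SimpleGraph.Subgraph.map_adj, Relation.Map,
        SimpleGraph.Subgraph.top_adj]
      constructor
      · rintro ⟨a, b, h, rfl, rfl⟩
        exact ⟨σ a, σ b, σ.map_adj_iff.2 h, rfl, rfl⟩
      · rintro ⟨a, b, h, rfl, rfl⟩
        exact ⟨σ.symm a, σ.symm b, σ.symm.map_adj_iff.2 h, by simp, by simp⟩
  · intro σ τ h
    ext x
    have := congrArg (fun f : {f : SimpleGraph.Copy H G // f.toSubgraph = f₀.toSubgraph} =>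
      f.1 x) h
    exact f₀.injective this
  · rintro ⟨f, hf⟩
    have hadj : ∀ x y, H.Adj x y → f.toSubgraph.Adj (f x) (f y) := fun x y h => by
      simp only [SimpleGraph.Copy.toSubgraph, SimpleGraph.Subgraph.map_adj, Relation.Map,
        SimpleGraph.Subgraph.top_adj]
      exact ⟨x, y, h, rfl, rfl⟩
    have hr : Set.range f = Set.range f₀ := by
      have := congrArg SimpleGraph.Subgraph.verts hf
      simpa [SimpleGraph.Copy.toSubgraph] using this
    choose g hg using fun x => (hr ▸ Set.mem_range_self x : f x ∈ Set.range f₀)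
    choose g' hg' using fun x => (hr ▸ Set.mem_range_self x : f₀ x ∈ Set.range f)
    have hg1 : ∀ x, g' (g x) = x := fun x => f.injective ((hg' _).trans (hg _))
    have hg2 : ∀ x, g (g' x) = x := fun x => f₀.injective ((hg _).trans (hg' _))
    have hto : ∀ x y, H.Adj x y → H.Adj (g x) (g y) := fun x y h => by
      have h1 := hadj x y h
      rw [hf] at h1
      simp only [SimpleGraph.Copy.toSubgraph, SimpleGraph.Subgraph.map_adj, Relation.Map,
        SimpleGraph.Subgraph.top_adj] at h1
      obtain ⟨a, b, hab, ha, hb⟩ := h1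
      have ha' : a = g x := f₀.injective (ha.trans (hg x).symm)
      have hb' : b = g y := f₀.injective (hb.trans (hg y).symm)
      exact ha' ▸ hb' ▸ hab
    have hback : ∀ x y, H.Adj (g x) (g y) → H.Adj x y := fun x y h => by
      have h1 : f₀.toSubgraph.Adj (f₀ (g x)) (f₀ (g y)) := by
        simp only [SimpleGraph.Copy.toSubgraph, SimpleGraph.Subgraph.map_adj, Relation.Map,
          SimpleGraph.Subgraph.top_adj]
        exact ⟨_, _, h, rfl, rfl⟩
      rw [← hf, hg, hg] at h1
      simp only [SimpleGraph.Copy.toSubgraph, SimpleGraph.Subgraph.map_adj, Relation.Map,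
        SimpleGraph.Subgraph.top_adj] at h1
      obtain ⟨a, b, hab, ha, hb⟩ := h1
      exact (f.injective ha : a = x) ▸ (f.injective hb : b = y) ▸ hab
    refine ⟨⟨⟨g, g', hg1, hg2⟩, ⟨hback _ _, hto _ _⟩⟩, ?_⟩
    apply Subtype.ext
    ext x
    exact hg x

theorem card_aut_cycleGraph_three :
    Nat.card (SimpleGraph.cycleGraph 3 ≃g SimpleGraph.cycleGraph 3) = 6 := by
  have e : (SimpleGraph.cycleGraph 3 ≃g SimpleGraph.cycleGraph 3) ≃
      {σ : Equiv.Perm (Fin 3) // ∀ a b, (SimpleGraph.cycleGraph 3).Adj (σ a) (σ b) ↔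
        (SimpleGraph.cycleGraph 3).Adj a b} :=
    ⟨fun σ => ⟨σ.toEquiv, fun a b => σ.map_rel_iff⟩, fun σ => ⟨σ.1, fun {a b} => σ.2 a b⟩,
      fun _ => rfl, fun _ => rfl⟩
  rw [Nat.card_congr e, Nat.card_eq_fintype_card]
  decide +kernel

theorem card_aut_cycleGraph_four :
    Nat.card (SimpleGraph.cycleGraph 4 ≃g SimpleGraph.cycleGraph 4) = 8 := by
  have e : (SimpleGraph.cycleGraph 4 ≃g SimpleGraph.cycleGraph 4) ≃
      {σ : Equiv.Perm (Fin 4) // ∀ a b, (SimpleGraph.cycleGraph 4).Adj (σ a) (σ b) ↔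
        (SimpleGraph.cycleGraph 4).Adj a b} :=
    ⟨fun σ => ⟨σ.toEquiv, fun a b => σ.map_rel_iff⟩, fun σ => ⟨σ.1, fun {a b} => σ.2 a b⟩,
      fun _ => rfl, fun _ => rfl⟩
  rw [Nat.card_congr e, Nat.card_eq_fintype_card]
  decide +kernel

open scoped Classical in
/-- The adjacency indicator of a graph. -/
noncomputable def ind (G : SimpleGraph V) (a b : V) : ℝ := if G.Adj a b then 1 else 0

open scoped Classical in
/-- The indicator of distinctness. -/
noncomputable def neq (a b : V) : ℝ := if a = b then 0 else 1

/-- The number of closed walks of length three, that is, of labelled triangles. -/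
noncomputable def tri [Fintype V] (G : SimpleGraph V) : ℝ :=
  ∑ a, ∑ b, ∑ c, ind G a b * ind G b c * ind G a c

/-- The number of labelled four-cycles. -/
noncomputable def quad [Fintype V] (G : SimpleGraph V) : ℝ :=
  ∑ a, ∑ b, ∑ c, ∑ d, ind G a b * ind G b c * ind G c d * ind G a d * neq a c * neq b d

theorem ind_comm (G : SimpleGraph V) (a b : V) : ind G a b = ind G b a := by
  unfold ind
  congr 1
  rw [G.adj_comm]

theorem ind_self (G : SimpleGraph V) (a : V) : ind G a a = 0 := by simp [ind]

theorem neq_comm (a b : V) : neq a b = neq b a := by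
  unfold neq
  congr 1
  exact propext eq_comm

theorem card_copy_three [Fintype V] (G : SimpleGraph V) :
    (Nat.card (SimpleGraph.Copy (SimpleGraph.cycleGraph 3) G) : ℝ) = tri G := by
  classical
  have e : SimpleGraph.Copy (SimpleGraph.cycleGraph 3) G ≃
      {p : V × V × V // G.Adj p.1 p.2.1 ∧ G.Adj p.2.1 p.2.2 ∧ G.Adj p.1 p.2.2} := by
    refine ⟨fun f => ⟨(f 0, f 1, f 2), f.toHom.map_adj (by decide), f.toHom.map_adj (by decide),
      f.toHom.map_adj (by decide)⟩, fun p => ⟨⟨![p.1.1, p.1.2.1, p.1.2.2], ?_⟩, ?_⟩, ?_, ?_⟩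
    · obtain ⟨⟨a, b, c⟩, h1, h2, h3⟩ := p
      intro i j hij
      fin_cases i <;> fin_cases j <;> first | exact absurd hij (by decide) | simp_all [G.adj_comm]
    · obtain ⟨⟨a, b, c⟩, h1, h2, h3⟩ := p
      intro i j hij
      have := h1.ne
      have := h2.ne
      have := h3.ne
      have := h1.ne'
      have := h2.ne'
      have := h3.ne'
      fin_cases i <;> fin_cases j <;> simp_all
    · intro f
      ext i
      fin_cases i <;> rfl
    · intro p
      rfl
  rw [Nat.card_congr e, Nat.card_eq_fintype_card, Fintype.card_subtype, ← Finset.sum_boole]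
  simp only [Fintype.sum_prod_type, tri, ind]
  refine Finset.sum_congr rfl fun a _ => Finset.sum_congr rfl fun b _ =>
    Finset.sum_congr rfl fun c _ => ?_
  split_ifs <;> simp_all

theorem card_copy_four [Fintype V] (G : SimpleGraph V) :
    (Nat.card (SimpleGraph.Copy (SimpleGraph.cycleGraph 4) G) : ℝ) = quad G := by
  classical
  have e : SimpleGraph.Copy (SimpleGraph.cycleGraph 4) G ≃
      {p : V × V × V × V // G.Adj p.1 p.2.1 ∧ G.Adj p.2.1 p.2.2.1 ∧ G.Adj p.2.2.1 p.2.2.2 ∧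
        G.Adj p.1 p.2.2.2 ∧ p.1 ≠ p.2.2.1 ∧ p.2.1 ≠ p.2.2.2} := by
    refine ⟨fun f => ⟨(f 0, f 1, f 2, f 3), f.toHom.map_adj (by decide), f.toHom.map_adj (by decide),
      f.toHom.map_adj (by decide), f.toHom.map_adj (by decide), f.injective.ne (by decide),
      f.injective.ne (by decide)⟩,
      fun p => ⟨⟨![p.1.1, p.1.2.1, p.1.2.2.1, p.1.2.2.2], ?_⟩, ?_⟩, ?_, ?_⟩
    · obtain ⟨⟨a, b, c, d⟩, h1, h2, h3, h4, h5, h6⟩ := p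
      intro i j hij
      fin_cases i <;> fin_cases j <;> first | exact absurd hij (by decide) | simp_all [G.adj_comm]
    · obtain ⟨⟨a, b, c, d⟩, h1, h2, h3, h4, h5, h6⟩ := p
      intro i j hij
      have := h1.ne
      have := h2.ne
      have := h3.ne
      have := h4.ne
      have := h1.ne'
      have := h2.ne'
      have := h3.ne'
      have := h4.ne'
      have := Ne.symm h5
      have := Ne.symm h6
      fin_cases i <;> fin_cases j <;> simp_all
    · intro f
      ext i
      fin_cases i <;> rfl
    · intro p
      rfl
  rw [Nat.card_congr e, Nat.card_eq_fintype_card, Fintype.card_subtype, ← Finset.sum_boole]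
  simp only [Fintype.sum_prod_type, quad, ind, neq]
  refine Finset.sum_congr rfl fun a _ => Finset.sum_congr rfl fun b _ =>
    Finset.sum_congr rfl fun c _ => Finset.sum_congr rfl fun d _ => ?_
  split_ifs <;> simp_all

theorem density_three [Fintype V] (G : SimpleGraph V) :
    density 3 G = tri G / (6 * Fintype.card V) := by
  have h := card_copy_eq_copyCount_mul G (SimpleGraph.cycleGraph 3)
  rw [card_aut_cycleGraph_three] at h
  rw [density, ← card_copy_three, h]
  push_cast
  rw [mul_comm, mul_div_mul_left _ _ (by norm_num)]

theorem density_four [Fintype V] (G : SimpleGraph V) :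
    density 4 G = quad G / (8 * Fintype.card V) := by
  have h := card_copy_eq_copyCount_mul G (SimpleGraph.cycleGraph 4)
  rw [card_aut_cycleGraph_four] at h
  rw [density, ← card_copy_four, h]
  push_cast
  rw [mul_comm, mul_div_mul_left _ _ (by norm_num)]

end Counting

/-! ### The local energy and merging along edges -/

section Local

variable {V : Type*}

/-- The indicator of the reflexive closure of the adjacency relation. -/
noncomputable def ref (G : SimpleGraph V) (a b : V) : ℝ := ind G a b + (1 - neq a b)

theorem ref_self (G : SimpleGraph V) (a : V) : ref G a a = 1 := by simp [ref, ind, neq]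

theorem ref_comm (G : SimpleGraph V) (a b : V) : ref G a b = ref G b a := by
  rw [ref, ref, ind_comm, neq_comm]

theorem ref_of_adj {G : SimpleGraph V} {a b : V} (h : G.Adj a b) : ref G a b = 1 := by
  simp [ref, ind, neq, h, h.ne]

theorem ref_of_not_adj {G : SimpleGraph V} {a b : V} (h : ¬ G.Adj a b) (hne : a ≠ b) :
    ref G a b = 0 := by
  simp [ref, ind, neq, h, hne]

theorem ref_eq_zero_or_one (G : SimpleGraph V) (a b : V) : ref G a b = 0 ∨ ref G a b = 1 := by
  by_cases hne : a = b
  · right; rw [hne, ref_self]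
  · by_cases h : G.Adj a b
    · right; exact ref_of_adj h
    · left; exact ref_of_not_adj h hne

/-- The triple kernel of the local functional. -/
noncomputable def ker3 (G : SimpleGraph V) (x y z : V) : ℝ :=
  2 * ref G x y * ref G y z - ref G x y * ref G y z * ref G x z

variable [Fintype V]

/-- The cubic form of the triple kernel. -/
noncomputable def cubicForm (G : SimpleGraph V) (w : V → ℝ) : ℝ :=
  ∑ x, w x * ∑ y, w y * ∑ z, w z * ker3 G x y z

/-- The quadratic form of the reflexive adjacency matrix. -/
noncomputable def quadraticForm (G : SimpleGraph V) (w : V → ℝ) : ℝ :=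
  ∑ x, w x * ∑ y, w y * ref G x y

/-- The local functional of a weighting of the vertices. -/
noncomputable def energy (G : SimpleGraph V) (ν : ℝ) (w : V → ℝ) : ℝ :=
  cubicForm G w - ν * quadraticForm G w

/-- Moving weight from `u` to `v`. -/
noncomputable def shift [DecidableEq V] (w : V → ℝ) (u v : V) (t : ℝ) (x : V) : ℝ :=
  w x + t * ((if x = v then 1 else 0) - (if x = u then 1 else 0))

theorem sum_shift_mul [DecidableEq V] (w : V → ℝ) (u v : V) (t : ℝ) (F : V → ℝ) :
    ∑ x, shift w u v t x * F x = ∑ x, w x * F x + t * (F v - F u) := by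
  simp [shift, add_mul, sum_add_distrib, mul_assoc, ← mul_sum, sub_mul, sum_sub_distrib]

theorem sum_shift_mul_poly [DecidableEq V] (w : V → ℝ) (u v : V) (t : ℝ) (P Q R : V → ℝ) :
    ∑ x, shift w u v t x * (P x + t * Q x + t ^ 2 * R x) = ∑ x, w x * P x +
      t * (∑ x, w x * Q x + (P v - P u)) + t ^ 2 * (∑ x, w x * R x + (Q v - Q u)) +
      t ^ 3 * (R v - R u) := by
  rw [sum_shift_mul]
  simp only [mul_add, sum_add_distrib, mul_left_comm _ t, mul_left_comm _ (t ^ 2), ← mul_sum]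
  ring

/-- Adjacent vertices look alike to the reflexive adjacency matrix restricted to `{u, v}`, so the
top-order term in `t` cancels in both forms: the cubic form becomes quadratic and the quadratic form
affine. The remaining `t ^ 2` coefficient is minus a weighted sum of squares, which gives concavity.
-/
theorem energy_shift [DecidableEq V] (G : SimpleGraph V) (ν : ℝ) (w : V → ℝ) (hw : ∀ x, 0 ≤ w x)
    {u v : V} (h : G.Adj u v) : ∃ A B : ℝ, B ≤ 0 ∧
      ∀ t, energy G ν (shift w u v t) = energy G ν w + A * t + B * t ^ 2 := by
  have huv := ref_of_adj h
  have hvu := ref_of_adj h.symm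
  have huu := ref_self G u
  have hvv := ref_self G v
  have hcub : ∃ A B : ℝ, B ≤ 0 ∧
      ∀ t, cubicForm G (shift w u v t) = cubicForm G w + A * t + B * t ^ 2 := by
    have h1 : ∀ t x y, ∑ z, shift w u v t z * ker3 G x y z =
        ∑ z, w z * ker3 G x y z + t * (ker3 G x y v - ker3 G x y u) + t ^ 2 * 0 := fun t x y => by
      rw [sum_shift_mul]; ring
    have h2 : ∀ t x, ∑ y, shift w u v t y * ∑ z, shift w u v t z * ker3 G x y z =
        ∑ y, w y * ∑ z, w z * ker3 G x y z +
        t * (∑ y, w y * (ker3 G x y v - ker3 G x y u) +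
          (∑ z, w z * ker3 G x v z - ∑ z, w z * ker3 G x u z)) +
        t ^ 2 * (ker3 G x v v - ker3 G x v u - (ker3 G x u v - ker3 G x u u)) := fun t x => by
      simp only [h1]
      rw [sum_shift_mul_poly]
      simp
    refine ⟨∑ x, w x * (∑ y, w y * (ker3 G x y v - ker3 G x y u) +
      (∑ z, w z * ker3 G x v z - ∑ z, w z * ker3 G x u z)) +
      (∑ y, w y * ∑ z, w z * ker3 G v y z - ∑ y, w y * ∑ z, w z * ker3 G u y z),
      ∑ z, w z * (ker3 G z v v - ker3 G z v u - (ker3 G z u v - ker3 G z u u)) +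
      (∑ z, w z * (ker3 G v z v - ker3 G v z u) + (∑ z, w z * ker3 G v v z -
        ∑ z, w z * ker3 G v u z) - (∑ z, w z * (ker3 G u z v - ker3 G u z u) +
        (∑ z, w z * ker3 G u v z - ∑ z, w z * ker3 G u u z))), ?_, fun t => ?_⟩
    rotate_left 1
    · simp only [cubicForm, h2]
      rw [sum_shift_mul_poly]
      -- The kernel equals `1` on all triples from `{u, v}`, so its third difference vanishes.
      have : ker3 G v v v - ker3 G v v u - (ker3 G v u v - ker3 G v u u) -
          (ker3 G u v v - ker3 G u v u - (ker3 G u u v - ker3 G u u u)) = 0 := by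
        simp only [ker3, huu, hvv, huv, hvu]; ring
      rw [this, mul_zero, add_zero, mul_comm t, mul_comm (t ^ 2)]
    · simp only [← sum_sub_distrib, ← sum_add_distrib, ← mul_sub, ← mul_add]
      -- The bracket is `-(ref G u z - ref G v z) ^ 2`: the outer two slots each contribute this
      -- value and the middle slot its negative.
      refine sum_nonpos fun z _ => mul_nonpos_of_nonneg_of_nonpos (hw z) ?_
      simp only [ker3, huu, hvv, huv, hvu, ref_comm G z u, ref_comm G z v]
      rcases ref_eq_zero_or_one G u z with h1 | h1 <;>
        rcases ref_eq_zero_or_one G v z with h2 | h2 <;> rw [h1, h2] <;> norm_num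
  have hquad : ∃ A : ℝ, ∀ t, quadraticForm G (shift w u v t) = quadraticForm G w + A * t := by
    refine ⟨∑ x, w x * (ref G x v - ref G x u) +
      (∑ y, w y * ref G v y - ∑ y, w y * ref G u y), fun t => ?_⟩
    · have h1 : ∀ x, ∑ y, shift w u v t y * ref G x y =
          ∑ y, w y * ref G x y + t * (ref G x v - ref G x u) + t ^ 2 * 0 := fun x => by
        rw [sum_shift_mul]; ring
      simp only [quadraticForm, h1]
      rw [sum_shift_mul_poly]
      simp only [huu, hvv, huv, hvu]
      simp only [sub_self, mul_zero, add_zero, sum_const_zero, mul_comm t]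
  obtain ⟨A, B, hB, hA⟩ := hcub
  obtain ⟨A', hA'⟩ := hquad
  refine ⟨A - ν * A', B, hB, fun t => ?_⟩
  rw [energy, hA, hA', energy]
  ring

/-- Moving all the weight of one of two adjacent vertices to the other does not increase the
energy, in the weighted average. -/
theorem energy_merge_le [DecidableEq V] (G : SimpleGraph V) (ν : ℝ) (w : V → ℝ)
    (hw : ∀ x, 0 ≤ w x) {u v : V} (h : G.Adj u v) :
    w u * energy G ν (Function.update (Function.update w u (w u + w v)) v 0) +
      w v * energy G ν (Function.update (Function.update w v (w u + w v)) u 0) ≤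
      (w u + w v) * energy G ν w := by
  obtain ⟨A, B, hB, hE⟩ := energy_shift G ν w hw h
  have h1 : Function.update (Function.update w u (w u + w v)) v 0 = shift w u v (- w v) := by
    ext x
    rcases eq_or_ne x v with rfl | hv
    · simp [shift, h.ne']
    · rcases eq_or_ne x u with rfl | hu
      · simp [shift, hv]
      · simp [shift, hu, hv]
  have h2 : Function.update (Function.update w v (w u + w v)) u 0 = shift w u v (w u) := by
    ext x
    rcases eq_or_ne x v with rfl | hv
    · simp [shift, h.ne', add_comm]
    · rcases eq_or_ne x u with rfl | hu
      · simp [shift, hv]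
      · simp [shift, hu, hv]
  rw [h1, h2, hE, hE]
  have := mul_nonpos_of_nonneg_of_nonpos (mul_nonneg (mul_nonneg (hw u) (hw v))
    (add_nonneg (hw u) (hw v))) hB
  nlinarith

/-- On a weighting with independent support the energy is a sum over the vertices. -/
theorem energy_of_independent (G : SimpleGraph V) (ν : ℝ) (w : V → ℝ)
    (hw : ∀ x y, w x ≠ 0 → w y ≠ 0 → ¬ G.Adj x y) :
    energy G ν w = ∑ x, (w x ^ 3 - ν * w x ^ 2) := by
  classical
  have key : ∀ x y, w x * (w y * ref G x y) = if x = y then w x ^ 2 else 0 := fun x y => by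
    split_ifs with hxy
    · subst hxy; rw [ref_self]; ring
    · by_cases hx : w x = 0
      · simp [hx]
      · by_cases hy : w y = 0
        · simp [hy]
        · rw [ref_of_not_adj (hw x y hx hy) hxy]; ring
  have hq : quadraticForm G w = ∑ x, w x ^ 2 := by
    simp only [quadraticForm, mul_sum, key, sum_ite_eq, mem_univ, if_true]
  have hc : cubicForm G w = ∑ x, w x ^ 3 := by
    have key3 : ∀ x y z, w x * (w y * (w z * ker3 G x y z)) =
        if y = z then (if x = y then w x ^ 3 else 0) else 0 := fun x y z => by
      have h1 := key x y
      have h2 := key y z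
      have : w x * (w y * (w z * ker3 G x y z)) =
          2 * (w x * (w y * ref G x y)) * (w z * ref G y z) -
            (w x * (w y * ref G x y)) * (w z * ref G y z) * ref G x z := by
        rw [ker3]; ring
      rw [this, h1]
      split_ifs with hxy hyz hyz
      · subst hxy hyz; rw [ref_self]; ring
      · subst hxy
        rw [if_neg hyz] at h2
        linear_combination (2 * w x - w x * ref G x z) * h2
      · ring
      · ring
    simp only [cubicForm, mul_sum, key3, sum_ite_eq, mem_univ, if_true]
  rw [energy, hq, hc, mul_sum, ← sum_sub_distrib]

end Local

/-! ### Partitions into almost equal parts -/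

section EqualParts

/-- The sum of `f` over the parts of the partition of `r` into `l` almost equal parts. -/
noncomputable def partSum (r l : ℕ) (f : ℕ → ℝ) : ℝ := ∑ i : Fin l, f (equalParts r l i)

theorem partSum_eq (r l : ℕ) (hl : 0 < l) (f : ℕ → ℝ) :
    partSum r l f = (l - (r % l : ℕ)) * f (r / l) + (r % l : ℕ) * f (r / l + 1) := by
  have hmod := Nat.mod_lt r hl
  have hdm := Nat.div_add_mod r l
  have hpart : ∀ i : Fin l, equalParts r l i = if (i : ℕ) < l - r % l then r / l else r / l + 1 := by
    intro i
    have hi := i.2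
    rw [equalParts]
    split_ifs with h
    · rw [Nat.div_eq_iff hl]
      constructor
      · rw [mul_comm]; omega
      · rw [mul_comm]; omega
    · rw [Nat.div_eq_iff hl]
      constructor
      · rw [add_mul, mul_comm]; omega
      · rw [add_mul, mul_comm]; omega
  simp only [partSum, hpart]
  rw [Fin.sum_univ_eq_sum_range (fun i => f (if i < l - r % l then r / l else r / l + 1)) l]
  have hsplit : range l = range ((l - r % l) + r % l) := by congr 1; omega
  rw [hsplit, sum_range_add]
  rw [sum_congr rfl (g := fun _ => f (r / l)), sum_congr (s₁ := range (r % l)) rfl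
    (g := fun _ => f (r / l + 1))]
  · simp only [sum_const, card_range, nsmul_eq_mul]
    rw [Nat.cast_sub hmod.le]
  · intro i _
    rw [if_neg (by omega)]
  · intro i hi
    rw [mem_range] at hi
    rw [if_pos (by omega)]

/-- If all parts are `q` or `q + 1`, then sums over the parts are linear in the number of parts. -/
theorem partSum_of_mem_interval {r l q : ℕ} (hl : 0 < l) (h1 : q * l ≤ r) (h2 : r ≤ (q + 1) * l)
    (f : ℕ → ℝ) : partSum r l f = ((q + 1) * l - r) * f q + (r - q * l) * f (q + 1) := by
  rw [partSum_eq r l hl]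
  have hdm : ((l : ℝ) * (r / l : ℕ) + (r % l : ℕ)) = r := by exact_mod_cast Nat.div_add_mod r l
  rcases h2.lt_or_eq with h2 | h2
  · have : r / l = q := by
      rw [Nat.div_eq_iff hl]
      constructor
      · exact h1
      · rw [add_mul] at h2; omega
    rw [this] at hdm ⊢
    rw [← hdm]; ring
  -- At the right end all parts equal `q + 1` and the quotient jumps, but the interpolation formula
  -- still agrees.
  · have h3 : r / l = q + 1 := by rw [h2]; exact Nat.mul_div_cancel _ hl
    have h4 : r % l = 0 := by rw [h2]; exact Nat.mul_mod_left _ _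
    rw [h3, h4]
    have h5 : (r : ℝ) = (q + 1) * l := by exact_mod_cast h2
    rw [h5]
    push_cast
    ring

/-- All values are the minimum or one more, and the total fixes how often each occurs; hence the
values form the almost equal partition. -/
theorem partSum_congr_near {ι : Type*} (s : Finset ι) (w : ι → ℕ) (hs : s.Nonempty)
    (hw : ∀ x ∈ s, ∀ y ∈ s, w x ≤ w y + 1) (f : ℕ → ℝ) :
    ∑ x ∈ s, f (w x) = partSum (∑ x ∈ s, w x) s.card f := by
  classical
  obtain ⟨m, hm, hmin⟩ := s.exists_min_image w hs
  have hval : ∀ x ∈ s, w x = w m ∨ w x = w m + 1 := fun x hx => by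
    have := hmin x hx
    have := hw x hx m hm
    omega
  have hf : ∀ g : ℕ → ℝ, ∑ x ∈ s, g (w x) = (#s - #{x ∈ s | w x = w m + 1}) * g (w m) +
      #{x ∈ s | w x = w m + 1} * g (w m + 1) := fun g => by
    rw [← sum_filter_add_sum_filter_not s (fun x => w x = w m + 1),
      sum_congr rfl (g := fun _ => g (w m + 1)),
      sum_congr (s₁ := {x ∈ s | ¬ w x = w m + 1}) rfl (g := fun _ => g (w m))]
    · have := card_filter_add_card_filter_not (s := s) (fun x => w x = w m + 1)
      have h : (#s : ℝ) = #{x ∈ s | w x = w m + 1} + #{x ∈ s | ¬ w x = w m + 1} := by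
        exact_mod_cast this.symm
      simp only [sum_const, nsmul_eq_mul]
      rw [h]; ring
    · intro x hx
      rw [mem_filter] at hx
      rw [(hval x hx.1).resolve_right hx.2]
    · intro x hx
      rw [mem_filter] at hx
      rw [hx.2]
  have hsum := hf (fun n => n)
  have hle : #{x ∈ s | w x = w m + 1} ≤ #s := card_filter_le _ _
  have hsumN : ∑ x ∈ s, w x = w m * #s + #{x ∈ s | w x = w m + 1} := by
    have : ((∑ x ∈ s, w x : ℕ) : ℝ) = ((w m * #s + #{x ∈ s | w x = w m + 1} : ℕ) : ℝ) := by
      push_cast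
      push_cast at hsum
      rw [hsum]; ring
    exact_mod_cast this
  rw [hf, partSum_of_mem_interval (q := w m) hs.card_pos (by omega) (by rw [add_mul]; omega), hsumN]
  push_cast
  ring

theorem partSum_sub_smul (r l : ℕ) (f g : ℕ → ℝ) (c : ℝ) :
    partSum r l (fun n => f n - c * g n) = partSum r l f - c * partSum r l g := by
  simp [partSum, mul_sum]

theorem sum_equalParts {r l : ℕ} (hl : 0 < l) : ∑ i : Fin l, equalParts r l i = r := by
  have h := partSum_eq r l hl (fun n => n)
  have hdm : ((l : ℝ) * (r / l : ℕ) + (r % l : ℕ)) = r := by exact_mod_cast Nat.div_add_mod r l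
  have : ((∑ i : Fin l, equalParts r l i : ℕ) : ℝ) = r := by
    push_cast
    rw [partSum] at h
    rw [h, ← hdm]
    push_cast
    ring
  exact_mod_cast this

theorem equalParts_pos {r l : ℕ} (hlr : l ≤ r) (i : Fin l) : 0 < equalParts r l i := by
  have := i.2
  exact Nat.div_pos (by omega) (by omega)

/-- The sum of the squares of the parts. -/
noncomputable def partSq (r l : ℕ) : ℝ := partSum r l (fun n => (n : ℝ) ^ 2)

/-- The sum of the cubes of the parts. -/
noncomputable def partCube (r l : ℕ) : ℝ := partSum r l (fun n => (n : ℝ) ^ 3)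

theorem partSum_id {r l : ℕ} (hl : 0 < l) : partSum r l (fun n => (n : ℝ)) = r := by
  have := sum_equalParts (r := r) hl
  rw [partSum]
  exact_mod_cast this

end EqualParts

/-! ### Minimising the energy over integer weightings -/

section LocalMin

variable {V : Type*} [Fintype V]

theorem sum_update_update [DecidableEq V] {w : V → ℕ} {x y : V} (hxy : x ≠ y) (a b : ℕ) (f : ℕ → ℝ) :
    ∑ z, f (Function.update (Function.update w x a) y b z) =
      ∑ z, f (w z) + (f a - f (w x)) + (f b - f (w y)) := by
  have : ∀ z, f (Function.update (Function.update w x a) y b z) =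
      f (w z) + (if z = x then f a - f (w x) else 0) + (if z = y then f b - f (w y) else 0) := by
    intro z
    rcases eq_or_ne z y with rfl | hy
    · simp [hxy.symm]
    · rcases eq_or_ne z x with rfl | hx
      · simp [hy]
      · simp [hx, hy]
  simp [this, sum_add_distrib]

theorem sum_update_update_nat [DecidableEq V] {w : V → ℕ} {x y : V} (hxy : x ≠ y) {a b : ℕ}
    (hab : a + b = w x + w y) :
    ∑ z, Function.update (Function.update w x a) y b z = ∑ z, w z := by
  have h := sum_update_update (w := w) hxy a b (fun n => (n : ℝ))
  have hab' : (a : ℝ) + b = w x + w y := by exact_mod_cast hab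
  have : ((∑ z, Function.update (Function.update w x a) y b z : ℕ) : ℝ) = (∑ z, w z : ℕ) := by
    push_cast
    linarith
  exact_mod_cast this

/-- Among the integer weightings of a given sum, one minimises the energy and, among the minimisers,
has the smallest support. -/
theorem exists_lex_minimizer (r : ℕ) (F : (V → ℕ) → ℝ) (w₀ : V → ℕ) (hw₀ : ∑ x, w₀ x = r) :
    ∃ w : V → ℕ, ∑ x, w x = r ∧ F w ≤ F w₀ ∧ (∀ w' : V → ℕ, ∑ x, w' x = r → F w ≤ F w') ∧
      ∀ w' : V → ℕ, ∑ x, w' x = r → F w' = F w → #{x | w x ≠ 0} ≤ #{x | w' x ≠ 0} := by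
  classical
  have hfin : {w : V → ℕ | ∑ x, w x = r}.Finite := by
    refine (Set.finite_Iic (fun _ : V => r)).subset fun w hw x => ?_
    rw [← (hw : ∑ x, w x = r)]
    exact single_le_sum (fun _ _ => Nat.zero_le _) (mem_univ x)
  obtain ⟨w₁, hw₁, hmin₁⟩ := hfin.toFinset.exists_min_image F ⟨w₀, by simpa using hw₀⟩
  obtain ⟨w, hw, hmin⟩ := (hfin.toFinset.filter (fun w => F w = F w₁)).exists_min_image
    (fun w => #{x | w x ≠ 0}) ⟨w₁, by simpa using hw₁⟩
  simp only [mem_filter, Set.Finite.mem_toFinset, Set.mem_ofPred_eq] at hw hmin hw₁ hmin₁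
  refine ⟨w, hw.1, hw.2 ▸ hmin₁ _ hw₀, fun w' h' => hw.2 ▸ hmin₁ w' h', fun w' h' hF =>
    hmin w' ⟨h', hF.trans hw.2⟩⟩

theorem card_support_update_lt [DecidableEq V] {w : V → ℕ} {x y : V} (hx : w x ≠ 0) (hy : w y ≠ 0)
    (hxy : x ≠ y) (a : ℕ) :
    #{z | Function.update (Function.update w x a) y 0 z ≠ 0} < #{z | w z ≠ 0} := by
  apply card_lt_card
  rw [ssubset_iff_of_subset]
  · exact ⟨y, by simpa using hy, by simp⟩
  · intro z hz
    rcases eq_or_ne z y with rfl | hzy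
    · simp at hz
    · rcases eq_or_ne z x with rfl | hzx
      · simpa using hx
      · simpa [hzx, hzy] using hz

/-- The local inequality: the energy of a weighting of total weight `r` is at least that of a
partition of `r` into almost equal parts. -/
theorem exists_partition_le_energy (G : SimpleGraph V) (ν : ℝ) (w₀ : V → ℕ) {r : ℕ} (hr : 0 < r)
    (hw₀ : ∑ x, w₀ x = r) :
    ∃ l ∈ Icc 1 r, partCube r l - ν * partSq r l ≤ energy G ν (fun x => w₀ x) := by
  classical
  obtain ⟨w, hw, hle, hmin, hsupp⟩ :=
    exists_lex_minimizer r (fun w : V → ℕ => energy G ν (fun x => (w x : ℝ))) w₀ hw₀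
  have hcast : ∀ (x y : V) (a b : ℕ),
      (fun z => ((Function.update (Function.update w x a) y b z : ℕ) : ℝ)) =
        Function.update (Function.update (fun z => (w z : ℝ)) x a) y b := fun x y a b => by
    ext z
    rcases eq_or_ne z y with rfl | hzy
    · simp
    · rcases eq_or_ne z x with rfl | hzx
      · simp [hzy]
      · simp [hzx, hzy]
  -- Both merges along an edge have energy at least the minimum, while their positively weighted
  -- average is at most the minimum; so both are minimisers, with smaller support.
  have hind : ∀ x y, w x ≠ 0 → w y ≠ 0 → ¬ G.Adj x y := by
    intro x y hx hy hadj
    have h := energy_merge_le G ν (fun z => (w z : ℝ)) (fun _ => Nat.cast_nonneg _) hadj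
    have h1 := hmin _ ((sum_update_update_nat hadj.ne (a := w x + w y) (b := 0) rfl).trans hw)
    have h2 := hmin _ ((sum_update_update_nat hadj.ne' (a := w x + w y) (b := 0)
      (by omega)).trans hw)
    simp only [hcast] at h1 h2
    push_cast at h1 h2
    have hx' : (0 : ℝ) < w x := by exact_mod_cast Nat.pos_of_ne_zero hx
    have hy' : (0 : ℝ) < w y := by exact_mod_cast Nat.pos_of_ne_zero hy
    refine absurd (hsupp _ ((sum_update_update_nat hadj.ne (a := w x + w y) (b := 0) rfl).trans hw)
      ?_) (not_le.2 (card_support_update_lt hx hy hadj.ne _))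
    simp only [hcast]
    push_cast
    refine le_antisymm ?_ h1
    have h3 := mul_le_mul_of_nonneg_left h2 hy'.le
    refine le_of_mul_le_mul_left ?_ hx'
    linarith
  have hE : ∀ w' : V → ℕ, (∀ z, w z = 0 → w' z = 0) →
      energy G ν (fun x => (w' x : ℝ)) = ∑ x, ((w' x : ℝ) ^ 3 - ν * (w' x : ℝ) ^ 2) := fun w' hw' =>
    energy_of_independent G ν _ fun x y hx hy => hind x y
      (fun h => hx (by simp [hw' x h])) (fun h => hy (by simp [hw' y h]))
  have hnear : ∀ x y, w x ≠ 0 → w y ≠ 0 → w x ≤ w y + 1 := by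
    intro x y hx hy
    by_contra! hlt
    have hxy : x ≠ y := by rintro rfl; omega
    have hb : (1 : ℝ) ≤ w y := by exact_mod_cast Nat.one_le_iff_ne_zero.2 hy
    have hab : (w y : ℝ) + 2 ≤ w x := by exact_mod_cast hlt
    have hmerge : ∀ a b : ℕ, a + b = w x + w y →
        energy G ν (fun z => ((Function.update (Function.update w x a) y b z : ℕ) : ℝ)) =
        energy G ν (fun z => (w z : ℝ)) + ((a : ℝ) ^ 3 - ν * (a : ℝ) ^ 2 -
          ((w x : ℝ) ^ 3 - ν * (w x : ℝ) ^ 2)) + ((b : ℝ) ^ 3 - ν * (b : ℝ) ^ 2 -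
          ((w y : ℝ) ^ 3 - ν * (w y : ℝ) ^ 2)) := fun a b hab => by
      rw [hE _ fun z hz => ?_, hE w fun _ h => h,
        sum_update_update hxy a b (fun n => (n : ℝ) ^ 3 - ν * (n : ℝ) ^ 2)]
      have hzx : z ≠ x := fun h => hx (h ▸ hz)
      have hzy : z ≠ y := fun h => hy (h ▸ hz)
      simp [hzx, hzy, hz]
    have hm1 := hmerge (w x + w y) 0 rfl
    have hm2 := hmerge (w x - 1) (w y + 1) (by omega)
    have h1 := hmin _ ((sum_update_update_nat hxy (a := w x + w y) (b := 0) rfl).trans hw)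
    have h2 := hmin _ ((sum_update_update_nat hxy (a := w x - 1) (b := w y + 1)
      (by omega)).trans hw)
    have h3 := card_support_update_lt hx hy hxy (w x + w y)
    have h4 := hsupp _ ((sum_update_update_nat hxy (a := w x + w y) (b := 0) rfl).trans hw)
    rw [hm2] at h2
    rw [hm1] at h1 h4
    rw [Nat.cast_sub (by omega)] at h2
    push_cast at h1 h2 h4
    set a : ℝ := ((w x : ℕ) : ℝ)
    set b : ℝ := ((w y : ℕ) : ℝ)
    -- Moving one unit and merging completely change the energy by multiples of the same factor `3
    -- (a + b) - 2 ν`, with opposite signs. Minimality under the first forces the factor to be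
    -- nonpositive, and then the merge is also a minimiser, with smaller support.
    have e1 : (a - 1) ^ 3 - ν * (a - 1) ^ 2 - (a ^ 3 - ν * a ^ 2) +
        ((b + 1) ^ 3 - ν * (b + 1) ^ 2 - (b ^ 3 - ν * b ^ 2)) =
        -((a - b - 1) * (3 * (a + b) - 2 * ν)) := by ring
    have e2 : (a + b) ^ 3 - ν * (a + b) ^ 2 - (a ^ 3 - ν * a ^ 2) +
        (0 ^ 3 - ν * 0 ^ 2 - (b ^ 3 - ν * b ^ 2)) = a * b * (3 * (a + b) - 2 * ν) := by ring
    have h5 : 3 * (a + b) - 2 * ν ≤ 0 := by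
      by_contra! hpos
      have := mul_pos (by linarith : 0 < a - b - 1) hpos
      linarith
    have h6 : a * b * (3 * (a + b) - 2 * ν) ≤ 0 :=
      mul_nonpos_of_nonneg_of_nonpos (by nlinarith) h5
    have h7 := h4 (by linarith)
    omega
  have hEw := hE w fun _ h => h
  set s : Finset V := {x | w x ≠ 0} with hs
  have hsum : ∑ x ∈ s, w x = r := by rw [hs, sum_filter_ne_zero, hw]
  have hsne : s.Nonempty := by
    rw [nonempty_iff_ne_empty]
    intro h
    rw [h, sum_empty] at hsum
    omega
  refine ⟨#s, mem_Icc.2 ⟨hsne.card_pos, ?_⟩, ?_⟩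
  · rw [← hsum, card_eq_sum_ones]
    refine sum_le_sum fun x hx => Nat.one_le_iff_ne_zero.2 (by simpa [hs] using hx)
  · refine le_of_eq_of_le ?_ hle
    rw [hEw, partCube, partSq, ← partSum_sub_smul]
    have h := partSum_congr_near s w hsne (fun x hx y hy => hnear x y (by simpa [hs] using hx)
      (by simpa [hs] using hy)) (fun n => (n : ℝ) ^ 3 - ν * (n : ℝ) ^ 2)
    rw [hsum] at h
    rw [← h]
    refine sum_subset (subset_univ _) fun x _ hx => ?_
    have : w x = 0 := by simpa [hs] using hx
    simp [this]

end LocalMin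

/-! ### Cycle counts in graphs of hypergraphs of girth five -/

section Section

variable {V : Type*}

theorem injective_vec_two {α : Type*} {x y : α} (hxy : x ≠ y) : Function.Injective ![x, y] := by
  intro i j hij
  have := hxy.symm
  fin_cases i <;> fin_cases j <;> simp_all

theorem injective_vec_three {α : Type*} {x y z : α} (hxy : x ≠ y) (hyz : y ≠ z) (hxz : x ≠ z) :
    Function.Injective ![x, y, z] := by
  intro i j hij
  have := hxy.symm
  have := hyz.symm
  have := hxz.symm
  fin_cases i <;> fin_cases j <;> simp_all

theorem injective_vec_four {α : Type*} {x y z w : α} (hxy : x ≠ y) (hyz : y ≠ z) (hzw : z ≠ w)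
    (hxw : x ≠ w) (hxz : x ≠ z) (hyw : y ≠ w) : Function.Injective ![x, y, z, w] := by
  intro i j hij
  have := hxy.symm
  have := hyz.symm
  have := hzw.symm
  have := hxw.symm
  have := hxz.symm
  have := hyw.symm
  fin_cases i <;> fin_cases j <;> simp_all

/-- A hypergraph without Berge cycles of length two is linear. -/
theorem edge_unique {H : Hypergraph V} (hH : ∀ k, HasBergeCycle H k → 5 ≤ k) {E F : Set V}
    (hE : E ∈ H.edgeSet) (hF : F ∈ H.edgeSet) {x y : V} (hxy : x ≠ y) (hxE : x ∈ E) (hyE : y ∈ E)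
    (hxF : x ∈ F) (hyF : y ∈ F) : E = F := by
  by_contra hne
  have : HasBergeCycle H 2 := by
    refine ⟨le_rfl, (![x, y] : Fin 2 → V), (![E, F] : Fin 2 → Set V), injective_vec_two hxy,
      injective_vec_two hne, ?_⟩
    · intro j
      change Fin 2 at j
      fin_cases j
      · exact ⟨hE, hxE, hyE⟩
      · exact ⟨hF, hyF, hxF⟩
  exact absurd (hH 2 this) (by norm_num)

/-- In a hypergraph of girth at least five, three pairwise adjacent vertices share a hyperedge. -/
theorem exists_edge_of_triangle {H : Hypergraph V} (hH : ∀ k, HasBergeCycle H k → 5 ≤ k)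
    {x y z : V} (hxy : x ≠ y) (hyz : y ≠ z) (hxz : x ≠ z) (h1 : H.Adj x y) (h2 : H.Adj y z)
    (h3 : H.Adj x z) : ∃ E ∈ H.edgeSet, x ∈ E ∧ y ∈ E ∧ z ∈ E := by
  obtain ⟨E, hE, hxE, hyE⟩ := h1
  obtain ⟨F, hF, hyF, hzF⟩ := h2
  obtain ⟨K, hK, hxK, hzK⟩ := h3
  by_contra! hno
  have hEF : E ≠ F := by rintro rfl; exact hno E hE hxE hyE hzF
  have hFK : F ≠ K := by rintro rfl; exact hno F hF hxK hyF hzF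
  have hEK : E ≠ K := by rintro rfl; exact hno E hE hxE hyE hzK
  have : HasBergeCycle H 3 := by
    refine ⟨by norm_num, (![x, y, z] : Fin 3 → V), (![E, F, K] : Fin 3 → Set V),
      injective_vec_three hxy hyz hxz, injective_vec_three hEF hFK hEK, ?_⟩
    · intro j
      change Fin 3 at j
      fin_cases j
      · exact ⟨hE, hxE, hyE⟩
      · exact ⟨hF, hyF, hzF⟩
      · exact ⟨hK, hzK, hxK⟩
  exact absurd (hH 3 this) (by norm_num)

/-- In a hypergraph of girth at least five, the vertices of a four-cycle share a hyperedge. -/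
theorem exists_edge_of_four_cycle {H : Hypergraph V} (hH : ∀ k, HasBergeCycle H k → 5 ≤ k)
    {x y z w : V} (hxy : x ≠ y) (hyz : y ≠ z) (hzw : z ≠ w) (hxw : x ≠ w) (hxz : x ≠ z)
    (hyw : y ≠ w) (h1 : H.Adj x y) (h2 : H.Adj y z) (h3 : H.Adj z w) (h4 : H.Adj x w) :
    ∃ E ∈ H.edgeSet, x ∈ E ∧ y ∈ E ∧ z ∈ E ∧ w ∈ E := by
  by_cases hadj : H.Adj x z
  · obtain ⟨E, hE, hxE, hyE, hzE⟩ := exists_edge_of_triangle hH hxy hyz hxz h1 h2 hadj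
    obtain ⟨F, hF, hxF, hzF, hwF⟩ := exists_edge_of_triangle hH hxz hzw hxw hadj h3 h4
    obtain rfl := edge_unique hH hE hF hxz hxE hzE hxF hzF
    exact ⟨E, hE, hxE, hyE, hzE, hwF⟩
  obtain ⟨E, hE, hxE, hyE⟩ := h1
  obtain ⟨F, hF, hyF, hzF⟩ := h2
  obtain ⟨K, hK, hzK, hwK⟩ := h3
  obtain ⟨L, hL, hxL, hwL⟩ := h4
  have hEF : E ≠ F := by rintro rfl; exact hadj ⟨E, hE, hxE, hzF⟩
  have hEK : E ≠ K := by rintro rfl; exact hadj ⟨E, hE, hxE, hzK⟩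
  have hFL : F ≠ L := by rintro rfl; exact hadj ⟨F, hF, hxL, hzF⟩
  have hKL : K ≠ L := by rintro rfl; exact hadj ⟨K, hK, hxL, hzK⟩
  -- With `x` and `z` not adjacent, only `E = L` or `F = K` can coincide. Either makes `y` and `w`
  -- adjacent, and the triangle case with linearity then puts `x` and `z` in one hyperedge, a
  -- contradiction.
  by_cases hEL : E = L
  · subst hEL
    obtain ⟨E', hE', hy, hz, hw⟩ := exists_edge_of_triangle hH hyz hzw hyw ⟨F, hF, hyF, hzF⟩
      ⟨K, hK, hzK, hwK⟩ ⟨E, hE, hyE, hwL⟩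
    obtain rfl := edge_unique hH hE hE' hyw hyE hwL hy hw
    exact absurd ⟨E, hE, hxE, hz⟩ hadj
  by_cases hFK : F = K
  · subst hFK
    obtain ⟨E', hE', hx, hy, hw⟩ := exists_edge_of_triangle hH hxy hyw hxw ⟨E, hE, hxE, hyE⟩
      ⟨F, hF, hyF, hwK⟩ ⟨L, hL, hxL, hwL⟩
    obtain rfl := edge_unique hH hE' hF hyw hy hw hyF hwK
    exact absurd ⟨E', hE', hx, hzF⟩ hadj
  exfalso
  have : HasBergeCycle H 4 := by
    refine ⟨by norm_num, (![x, y, z, w] : Fin 4 → V), (![E, F, K, L] : Fin 4 → Set V),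
      injective_vec_four hxy hyz hzw hxw hxz hyw, injective_vec_four hEF hFK hKL hEL hEK hFL, ?_⟩
    · intro j
      change Fin 4 at j
      fin_cases j
      · exact ⟨hE, hxE, hyE⟩
      · exact ⟨hF, hyF, hzF⟩
      · exact ⟨hK, hzK, hwK⟩
      · exact ⟨hL, hwL, hxL⟩
  exact absurd (hH 4 this) (by norm_num)

/-- The neighbourhood of a vertex in the graph of a hypergraph of girth five is a disjoint union of
cliques, one per hyperedge, which contain all triangles and four-cycles through the vertex. -/
theorem IsHypergraphSection.exists_cliques [Fintype V] [DecidableEq V] {l : ℕ} {s : Fin l → ℕ}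
    {G : SimpleGraph V} (hG : IsHypergraphSection s G) (a : V) :
    ∃ A : Fin l → Finset V, (∀ i, #(A i) = s i) ∧ (∀ i j, i ≠ j → Disjoint (A i) (A j)) ∧
      (∀ i, a ∉ A i) ∧
      (∀ b, G.Adj a b ↔ ∃ i, b ∈ A i) ∧
      (∀ i, ∀ b ∈ A i, ∀ c ∈ A i, b ≠ c → G.Adj b c) ∧
      (∀ b c, G.Adj a b → G.Adj b c → G.Adj a c → ∃ i, b ∈ A i ∧ c ∈ A i) ∧
      (∀ b c d, G.Adj a b → G.Adj b c → G.Adj c d → G.Adj a d → a ≠ c → b ≠ d →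
        ∃ i, b ∈ A i ∧ c ∈ A i ∧ d ∈ A i) := by
  classical
  obtain ⟨H, -, hsize, hgirth, rfl⟩ := hG
  obtain ⟨e, hinj, hrange, hcard⟩ := hsize a
  have hmem : ∀ i, e i ∈ H.edgeSet ∧ a ∈ e i := fun i => by
    have : e i ∈ Set.range e := ⟨i, rfl⟩
    rw [hrange] at this
    exact this
  have hex : ∀ E ∈ H.edgeSet, a ∈ E → ∃ i, e i = E := fun E hE haE => by
    have : E ∈ Set.range e := by rw [hrange]; exact ⟨hE, haE⟩
    exact this
  have hadj : ∀ b c, (SimpleGraph.fromRel H.Adj).Adj b c ↔ b ≠ c ∧ H.Adj b c := fun b c => by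
    rw [SimpleGraph.fromRel_adj, H.adj_comm c b, or_self]
  simp only [hadj]
  refine ⟨fun i => (e i).toFinset.erase a, fun i => ?_, fun i j hij => ?_, fun i => by simp,
    fun b => ?_, fun i b hb c hc hbc => ?_, fun b c h1 h2 h3 => ?_,
    fun b c d h1 h2 h3 h4 h5 h6 => ?_⟩
  · rw [card_erase_of_mem (by simpa using (hmem i).2), ← Set.ncard_eq_toFinset_card', hcard]
    simp
  · rw [Finset.disjoint_left]
    intro b hbi hbj
    simp only [mem_erase, Set.mem_toFinset] at hbi hbj
    exact hij (hinj (edge_unique hgirth (hmem i).1 (hmem j).1 hbi.1 hbi.2 (hmem i).2 hbj.2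
      (hmem j).2))
  · constructor
    · rintro ⟨hne, E, hE, haE, hbE⟩
      obtain ⟨i, rfl⟩ := hex E hE haE
      exact ⟨i, by simp [hne.symm, hbE]⟩
    · rintro ⟨i, hi⟩
      simp only [mem_erase, Set.mem_toFinset] at hi
      exact ⟨hi.1.symm, e i, (hmem i).1, (hmem i).2, hi.2⟩
  · simp only [mem_erase, Set.mem_toFinset] at hb hc
    exact ⟨hbc, e i, (hmem i).1, hb.2, hc.2⟩
  · obtain ⟨E, hE, ha, hb, hc⟩ := exists_edge_of_triangle hgirth h1.1 h2.1 h3.1 h1.2 h2.2 h3.2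
    obtain ⟨i, rfl⟩ := hex E hE ha
    exact ⟨i, by simp [h1.1.symm, hb], by simp [h3.1.symm, hc]⟩
  · obtain ⟨E, hE, ha, hb, hc, hd⟩ := exists_edge_of_four_cycle hgirth h1.1 h2.1 h3.1 h4.1 h5 h6
      h1.2 h2.2 h3.2 h4.2
    obtain ⟨i, rfl⟩ := hex E hE ha
    exact ⟨i, by simp [h1.1.symm, hb], by simp [h5.symm, hc], by simp [h4.1.symm, hd]⟩

/-- The indicator of membership in a finite set. -/
noncomputable def mem01 [DecidableEq V] (A : Finset V) (b : V) : ℝ := if b ∈ A then 1 else 0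

theorem sum_mem01_mul [Fintype V] [DecidableEq V] (A : Finset V) (f : V → ℝ) :
    ∑ b, mem01 A b * f b = ∑ b ∈ A, f b := by
  simp [mem01]

theorem sum_neq [DecidableEq V] (A : Finset V) {b : V} (hb : b ∈ A) :
    ∑ c ∈ A, neq b c = #A - 1 := by
  have : ∀ c, neq b c = 1 - if b = c then 1 else 0 := fun c => by
    unfold neq; split_ifs <;> simp
  simp [this, hb]

theorem sum_neq_mul_neq [DecidableEq V] (A : Finset V) {b c : V} (hb : b ∈ A) (hc : c ∈ A)
    (hbc : b ≠ c) : ∑ d ∈ A, neq c d * neq b d = #A - 2 := by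
  have : ∀ d, neq c d * neq b d = 1 - (if c = d then 1 else 0) - if b = d then 1 else 0 := fun d => by
    unfold neq; split_ifs <;> simp_all
  simp [this, hb, hc]
  ring

theorem sum_neq_triple [DecidableEq V] (A : Finset V) :
    ∑ b ∈ A, ∑ c ∈ A, ∑ d ∈ A, neq b c * (neq c d * neq b d) =
      #A * (#A - 1) * (#A - 2) := by
  have h1 : ∀ b ∈ A, ∀ c ∈ A, ∑ d ∈ A, neq b c * (neq c d * neq b d) = neq b c * (#A - 2) :=
    fun b hb c hc => by
      rw [← mul_sum]
      by_cases hbc : b = c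
      · simp [neq, hbc]
      · rw [sum_neq_mul_neq A hb hc hbc]
  rw [sum_congr rfl fun b hb => sum_congr rfl (h1 b hb)]
  simp only [← sum_mul]
  rw [sum_congr rfl fun b hb => sum_neq A hb, sum_const, nsmul_eq_mul]

open scoped Classical in
theorem ind_triangle (G : SimpleGraph V) (a b c : V) : ind G a b * ind G b c * ind G a c =
    if G.Adj a b ∧ G.Adj b c ∧ G.Adj a c then 1 else 0 := by
  unfold ind; split_ifs <;> simp_all

open scoped Classical in
theorem ind_four_cycle (G : SimpleGraph V) (a b c d : V) :
    ind G a b * ind G b c * ind G c d * ind G a d * neq a c * neq b d =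
      if G.Adj a b ∧ G.Adj b c ∧ G.Adj c d ∧ G.Adj a d ∧ a ≠ c ∧ b ≠ d then 1 else 0 := by
  unfold ind neq; split_ifs <;> simp_all

open scoped Classical in
-- Disjointness makes the witness `i` unique, so an existential over cliques turns into a sum over
-- them.
theorem exists_mem_mem_indicator {l : ℕ} {A : Fin l → Finset V}
    (hdisj : ∀ i j, i ≠ j → Disjoint (A i) (A j)) (P : Fin l → Prop) (b : V) (f : ℝ)
    (hP : ∀ i, P i → b ∈ A i) (Q : Prop) (hQ : Q ↔ ∃ i, P i) :
    (if Q then f else 0) = ∑ i, if P i then f else 0 := by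
  by_cases h : Q
  · obtain ⟨i, hi⟩ := hQ.1 h
    rw [if_pos h, sum_eq_single i, if_pos hi]
    · intro j _ hji
      rw [if_neg fun hj => Finset.disjoint_left.1 (hdisj j i hji) (hP j hj) (hP i hi)]
    · simp
  · rw [if_neg h, sum_eq_zero]
    intro i _
    rw [if_neg fun hi => h (hQ.2 ⟨i, hi⟩)]

variable [Fintype V] {l : ℕ} {s : Fin l → ℕ} {G : SimpleGraph V}

theorem IsHypergraphSection.sum_ind (hG : IsHypergraphSection s G) (a : V) :
    ∑ b, ind G a b = ∑ i, (s i : ℝ) := by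
  classical
  obtain ⟨A, hcard, hdisj, -, hadj, -⟩ := hG.exists_cliques a
  have : ∀ b, ind G a b = ∑ i, if b ∈ A i then 1 else 0 := fun b => by
    unfold ind
    convert exists_mem_mem_indicator hdisj (fun i => b ∈ A i) b 1 (fun i h => h) _ (hadj b)
  simp only [this]
  rw [sum_comm]
  simp [hcard]

theorem IsHypergraphSection.tri_eq (hG : IsHypergraphSection s G) :
    tri G = Fintype.card V * ∑ i, (s i : ℝ) * (s i - 1) := by
  classical
  rw [tri, sum_congr rfl (g := fun _ => ∑ i, (s i : ℝ) * (s i - 1))]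
  · simp
  intro a _
  obtain ⟨A, hcard, hdisj, -, hadj, hclique, htri, -⟩ := hG.exists_cliques a
  have : ∀ b c, ind G a b * ind G b c * ind G a c =
      ∑ i, mem01 (A i) b * (mem01 (A i) c * neq b c) := fun b c => by
    have h := exists_mem_mem_indicator hdisj (fun i => b ∈ A i ∧ c ∈ A i ∧ b ≠ c) b 1
      (fun i h => h.1) (G.Adj a b ∧ G.Adj b c ∧ G.Adj a c) ⟨fun ⟨h1, h2, h3⟩ => by
        obtain ⟨i, hb, hc⟩ := htri b c h1 h2 h3
        exact ⟨i, hb, hc, h2.ne⟩, fun ⟨i, hb, hc, hbc⟩ =>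
        ⟨(hadj b).2 ⟨i, hb⟩, hclique i b hb c hc hbc, (hadj c).2 ⟨i, hc⟩⟩⟩
    refine Eq.trans ?_ (h.trans (sum_congr rfl fun i _ => ?_))
    · convert ind_triangle G a b c
    · unfold mem01 neq; split_ifs <;> grind
  simp only [this]
  rw [sum_congr rfl fun b _ => sum_comm, sum_comm]
  refine sum_congr rfl fun i _ => ?_
  simp only [← mul_sum, sum_mem01_mul]
  rw [sum_congr rfl fun b hb => sum_neq (A i) hb, sum_const, nsmul_eq_mul, hcard]

/-- A labelled four-cycle at a vertex is an ordered triple of distinct elements of one of its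
cliques; a clique of size `s` has `s (s-1) (s-2)` of them. -/
theorem IsHypergraphSection.quad_eq (hG : IsHypergraphSection s G) :
    quad G = Fintype.card V * ∑ i, (s i : ℝ) * (s i - 1) * (s i - 2) := by
  classical
  rw [quad, sum_congr rfl (g := fun _ => ∑ i, (s i : ℝ) * (s i - 1) * (s i - 2))]
  · simp
  intro a _
  obtain ⟨A, hcard, hdisj, hna, hadj, hclique, htri, hquad⟩ := hG.exists_cliques a
  have : ∀ b c d, ind G a b * ind G b c * ind G c d * ind G a d * neq a c * neq b d =
      ∑ i, mem01 (A i) b * (mem01 (A i) c * (mem01 (A i) d * (neq b c * (neq c d * neq b d)))) :=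
    fun b c d => by
    have h := exists_mem_mem_indicator hdisj
      (fun i => b ∈ A i ∧ c ∈ A i ∧ d ∈ A i ∧ b ≠ c ∧ c ≠ d ∧ b ≠ d) b 1
      (fun i h => h.1) (G.Adj a b ∧ G.Adj b c ∧ G.Adj c d ∧ G.Adj a d ∧ a ≠ c ∧ b ≠ d)
      ⟨fun ⟨h1, h2, h3, h4, h5, h6⟩ => by
        obtain ⟨i, hb, hc, hd⟩ := hquad b c d h1 h2 h3 h4 h5 h6
        exact ⟨i, hb, hc, hd, h2.ne, h3.ne, h6⟩, fun ⟨i, hb, hc, hd, hbc, hcd, hbd⟩ =>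
        ⟨(hadj b).2 ⟨i, hb⟩, hclique i b hb c hc hbc, hclique i c hc d hd hcd, (hadj d).2 ⟨i, hd⟩,
          fun h => hna i (h ▸ hc), hbd⟩⟩
    refine Eq.trans ?_ (h.trans (sum_congr rfl fun i _ => ?_))
    · convert ind_four_cycle G a b c d
    · unfold mem01 neq; split_ifs <;> grind
  simp only [this]
  rw [sum_congr rfl fun b _ => sum_congr rfl fun c _ => sum_comm,
    sum_congr rfl fun b _ => sum_comm, sum_comm]
  refine sum_congr rfl fun i _ => ?_
  simp only [← mul_sum, sum_mem01_mul]
  simp only [mul_sum]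
  rw [sum_neq_triple, hcard]

end Section

/-! ### Existence of the hypergraphs: finite groups of large girth -/

section Existence

/-- Left multiplication through `φ`, restricted to those elements of `S` whose orbit stays in `S`. -/
@[reducible] noncomputable def partialAction {M C : Type*} [Group M] [Group C] (φ : M →* C) (S : Set C) :
    MulAction M S := by
  classical
  exact
  { smul := fun m x => if h : ∀ m', φ m' * x ∈ S then ⟨φ m * x, h m⟩ else x
    one_smul := fun x => by
      change (if h : ∀ m', φ m' * x ∈ S then (⟨φ 1 * x, h 1⟩ : S) else x) = x
      split_ifs
      · ext; simp
      · rfl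
    mul_smul := fun m n x => by
      change (if h : ∀ m', φ m' * x ∈ S then (⟨φ (m * n) * x, h (m * n)⟩ : S) else x) =
        (fun y : S => if h : ∀ m', φ m' * y ∈ S then (⟨φ m * y, h m⟩ : S) else y)
        (if h : ∀ m', φ m' * x ∈ S then (⟨φ n * x, h n⟩ : S) else x)
      -- The condition is invariant along the orbit of `x`, so all terms take the same branch.
      by_cases h : ∀ m', φ m' * x ∈ S
      · have h' : ∀ m', φ m' * (φ n * x) ∈ S := fun m' => by
          rw [← mul_assoc, ← map_mul]; exact h _
        simp only [dif_pos h, dif_pos h']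
        ext
        simp [mul_assoc]
      · simp only [dif_neg h] }

theorem partialAction_smul {M C : Type*} [Group M] [Group C] (φ : M →* C) (S : Set C) (m : M)
    (x : S) (h : ∀ m', φ m' * x ∈ S) :
    (letI := partialAction φ S; ((m • x : S) : C)) = φ m * x := by
  change ((@dite _ _ (Classical.propDecidable _) _ _ : S) : C) = _
  rw [dif_pos h]

open scoped Pointwise in
/-- Free products of finite groups have finite quotients in which short reduced words do not
vanish. -/
theorem exists_finite_group_of_large_girth {ι : Type} [Finite ι] [Nonempty ι] (M : ι → Type)
    [∀ i, Group (M i)] [∀ i, Finite (M i)] (n : ℕ) :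
    ∃ (Γ : Type) (_ : Group Γ) (_ : Finite Γ) (ψ : ∀ i, M i →* Γ),
      ∀ L : List (Σ i, M i), L ≠ [] → L.length ≤ n → (∀ p ∈ L, p.2 ≠ 1) →
        L.IsChain (fun p q => p.1 ≠ q.1) → (L.map fun p => ψ p.1 p.2).prod ≠ 1 := by
  classical
  set T : Set (Monoid.CoprodI M) := ⋃ i, Set.range (Monoid.CoprodI.of : M i →* Monoid.CoprodI M)
    with hT
  have hTfin : T.Finite := Set.finite_iUnion fun i => Set.finite_range _
  have h1T : (1 : Monoid.CoprodI M) ∈ T := by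
    obtain ⟨i⟩ := ‹Nonempty ι›
    exact Set.mem_iUnion.2 ⟨i, 1, map_one _⟩
  have hSfin : (T ^ n).Finite := by
    clear_value T
    induction n with
    | zero => simp
    | succ n ih => rw [pow_succ]; exact ih.mul hTfin
  have : Finite (T ^ n : Set _) := hSfin
  have h1S : (1 : Monoid.CoprodI M) ∈ T ^ n := Set.one_mem_pow h1T
  refine ⟨Equiv.Perm (T ^ n : Set _), inferInstance, inferInstance, fun i =>
    letI := partialAction (Monoid.CoprodI.of : M i →* Monoid.CoprodI M) (T ^ n)
    MulAction.toPermHom (M i) (T ^ n : Set _), fun L hL hlen hne hchain hprod => ?_⟩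
  -- On the ball `T ^ n`, a word of length at most `n` applied to `1` never leaves the ball, so it
  -- acts by genuine multiplication. A trivial permutation would thus give a reduced word with
  -- product `1` in the free product.
  have key : ∀ L : List (Σ i, M i), L.length ≤ n →
      (((L.map fun p =>
        (letI := partialAction (Monoid.CoprodI.of : M p.1 →* Monoid.CoprodI M) (T ^ n)
        MulAction.toPermHom (M p.1) (T ^ n : Set _)) p.2).prod ⟨1, h1S⟩ : (T ^ n : Set _)) :
        Monoid.CoprodI M) = (L.map fun p => Monoid.CoprodI.of p.2).prod ∧
      (L.map fun p => Monoid.CoprodI.of p.2).prod ∈ T ^ L.length := by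
    intro L
    induction L with
    | nil => intro _; simp
    | cons p L ih =>
      intro hlen
      rw [List.length_cons] at hlen
      obtain ⟨h1, h2⟩ := ih (by omega)
      have hmem : ∀ m' : M p.1, Monoid.CoprodI.of m' *
          (L.map fun p => Monoid.CoprodI.of p.2).prod ∈ T ^ (L.length + 1) := fun m' => by
        rw [pow_succ']
        exact Set.mul_mem_mul (Set.mem_iUnion.2 ⟨p.1, m', rfl⟩) h2
      rw [List.map_cons, List.prod_cons, List.map_cons, List.prod_cons, List.length_cons]
      refine ⟨?_, hmem p.2⟩
      rw [Equiv.Perm.mul_apply, ← h1]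
      refine partialAction_smul _ _ p.2 _ fun m' => ?_
      rw [h1]
      exact Set.pow_subset_pow_right h1T hlen (hmem m')
  have h1 := (key L hlen).1
  rw [hprod] at h1
  have h2 : (⟨L, fun p hp => hne p hp, hchain⟩ : Monoid.CoprodI.Word M) =
      Monoid.CoprodI.Word.empty := by
    apply Monoid.CoprodI.Word.equiv.symm.injective
    change Monoid.CoprodI.Word.prod _ = Monoid.CoprodI.Word.prod _
    rw [Monoid.CoprodI.Word.prod_empty]
    exact h1.symm
  exact hL (congrArg Monoid.CoprodI.Word.toList h2)

/-- There are hypergraphs of girth at least five with prescribed sizes of the hyperedges at each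
vertex. -/
theorem exists_isHypergraphSection {l : ℕ} (hl : 0 < l) (s : Fin l → ℕ) (hs : ∀ i, 0 < s i) :
    ∃ (V : Type) (_ : Fintype V) (_ : Nonempty V) (G : SimpleGraph V),
      IsHypergraphSection s G := by
  classical
  have : Nonempty (Fin l) := ⟨⟨0, hl⟩⟩
  -- Only Berge cycles of length `2`, `3` or `4` must be excluded, so words of length at most `4`
  -- suffice.
  obtain ⟨Γ, _, _, ψ, hψ⟩ := exists_finite_group_of_large_girth
    (fun i : Fin l => Multiplicative (ZMod (s i + 1))) 4
  set coset : Γ → Fin l → Set Γ := fun x i => Set.range fun m => x * ψ i m with hcoset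
  have hself : ∀ x i, x ∈ coset x i := fun x i => ⟨1, by simp⟩
  have hrebase : ∀ x y i, y ∈ coset x i → coset y i = coset x i := by
    rintro x _ i ⟨m, rfl⟩
    ext z
    constructor
    · rintro ⟨n, rfl⟩
      exact ⟨m * n, by simp [mul_assoc]⟩
    · rintro ⟨n, rfl⟩
      exact ⟨m⁻¹ * n, by simp [mul_assoc]⟩
  have hinj1 : ∀ i m, ψ i m = 1 → m = 1 := fun i m h => by
    by_contra hm
    exact hψ [⟨i, m⟩] (by simp) (by simp) (by simpa using hm) (by simp) (by simpa using h)
  have hinj : ∀ i, Function.Injective (ψ i) := fun i =>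
    (injective_iff_map_eq_one (ψ i)).2 (hinj1 i)
  have hcosetne : ∀ x i j, i ≠ j → coset x i ≠ coset x j := by
    intro x i j hij h
    have hn : Nontrivial (Multiplicative (ZMod (s i + 1))) := by
      have : Fact (1 < s i + 1) := ⟨by have := hs i; omega⟩
      infer_instance
    obtain ⟨m, hm⟩ := exists_ne (1 : Multiplicative (ZMod (s i + 1)))
    have : x * ψ i m ∈ coset x j := h ▸ ⟨m, rfl⟩
    obtain ⟨n, hn⟩ := this
    have hn' : ψ j n = ψ i m := mul_left_cancel hn
    have hn1 : n ≠ 1 := fun h1 => hm (hinj1 i m (by rw [← hn', h1, map_one]))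
    exact hψ [⟨i, m⟩, ⟨j, n⁻¹⟩] (by simp) (by simp) (by simp [hm, hn1]) (by simp [hij])
      (by simp [hn'])
  refine ⟨Γ, Fintype.ofFinite Γ, ⟨1⟩, _, ⟨⟨Set.univ, {E | ∃ x i, E = coset x i},
    fun _ _ => Set.subset_univ _⟩, rfl, fun x => ⟨coset x, ?_, ?_, fun i => ?_⟩, ?_, rfl⟩⟩
  · intro i j hij
    by_contra hne
    exact hcosetne x i j hne hij
  · ext E
    constructor
    · rintro ⟨i, rfl⟩
      exact ⟨⟨x, i, rfl⟩, hself x i⟩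
    · rintro ⟨⟨y, i, rfl⟩, hx⟩
      exact ⟨i, hrebase _ _ _ hx⟩
  · have : Function.Injective fun m => x * ψ i m := fun m n h => hinj i (mul_left_cancel h)
    change (Set.range fun m => x * ψ i m).ncard = s i + 1
    rw [← Set.image_univ, Set.ncard_image_of_injective _ this, Set.ncard_univ]
    simp
  · rintro k ⟨hk2, x, e, hx, he, hxe⟩
    by_contra! hk
    have hne1 : ∀ j : ZMod k, j ≠ j + 1 := fun j h => by
      have : Fact (1 < k) := ⟨hk2⟩
      exact one_ne_zero (left_eq_add.1 h)
    have hexi : ∀ j, ∃ i, e j = coset (x j) i := fun j => by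
      obtain ⟨⟨y, i, hyi⟩, hxj, -⟩ := hxe j
      exact ⟨i, by rw [hyi] at hxj ⊢; exact (hrebase _ _ _ hxj).symm⟩
    choose i hi using hexi
    -- The steps `m j` around the cycle spell a word with product `1`. It is reduced: distinct
    -- vertices make the letters nontrivial, and distinct hyperedges make consecutive indices
    -- differ.
    have hexm : ∀ j, ∃ m, x j * ψ (i j) m = x (j + 1) := fun j => by
      have := (hxe j).2.2
      rw [hi j] at this
      exact this
    choose m hm using hexm
    have hm1 : ∀ j, m j ≠ 1 := fun j h => hne1 j (hx (by rw [← hm j, h, map_one, mul_one]))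
    have hii : ∀ j, i j ≠ i (j + 1) := fun j h => hne1 j (he (by
      rw [hi j, hi (j + 1), ← h]
      exact (hrebase _ _ _ ⟨m j, hm j⟩).symm))
    have step : ∀ j z, x j * (ψ (i j) (m j) * z) = x (j + 1) * z := fun j z => by
      rw [← mul_assoc, hm]
    interval_cases k
    · have e0 : (0 + 1 : ZMod 2) = 1 := rfl
      have e1 : (1 + 1 : ZMod 2) = 0 := rfl
      have hi0 := hii 0
      rw [e0] at hi0
      refine hψ [⟨i 0, m 0⟩, ⟨i 1, m 1⟩] (by simp) (by simp) (by simp [hm1]) (by simp [hi0])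
        (mul_left_cancel (a := x 0) ?_)
      simp only [List.map_cons, List.map_nil, List.prod_cons, List.prod_nil]
      rw [step, e0, step, e1]
    · have e0 : (0 + 1 : ZMod 3) = 1 := rfl
      have e1 : (1 + 1 : ZMod 3) = 2 := rfl
      have e2 : (2 + 1 : ZMod 3) = 0 := rfl
      have hi0 := hii 0
      have hi1 := hii 1
      rw [e0] at hi0
      rw [e1] at hi1
      refine hψ [⟨i 0, m 0⟩, ⟨i 1, m 1⟩, ⟨i 2, m 2⟩] (by simp) (by simp) (by simp [hm1])
        (by simp [hi0, hi1]) (mul_left_cancel (a := x 0) ?_)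
      simp only [List.map_cons, List.map_nil, List.prod_cons, List.prod_nil]
      rw [step, e0, step, e1, step, e2]
    · have e0 : (0 + 1 : ZMod 4) = 1 := rfl
      have e1 : (1 + 1 : ZMod 4) = 2 := rfl
      have e2 : (2 + 1 : ZMod 4) = 3 := rfl
      have e3 : (3 + 1 : ZMod 4) = 0 := rfl
      have hi0 := hii 0
      have hi1 := hii 1
      have hi2 := hii 2
      rw [e0] at hi0
      rw [e1] at hi1
      rw [e2] at hi2
      refine hψ [⟨i 0, m 0⟩, ⟨i 1, m 1⟩, ⟨i 2, m 2⟩, ⟨i 3, m 3⟩] (by simp) (by simp)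
        (by simp [hm1]) (by simp [hi0, hi1, hi2]) (mul_left_cancel (a := x 0) ?_)
      simp only [List.map_cons, List.map_nil, List.prod_cons, List.prod_nil]
      rw [step, e0, step, e1, step, e2, step, e3]

end Existence

/-! ### Lower and upper bounds for regular graphs -/

section Bounds

variable {V : Type*}

theorem ind_mul_self (G : SimpleGraph V) (a b : V) : ind G a b * ind G a b = ind G a b := by
  unfold ind; split_ifs <;> simp

theorem ind_nonneg (G : SimpleGraph V) (a b : V) : 0 ≤ ind G a b := by
  unfold ind; split_ifs <;> norm_num

theorem ind_le_one (G : SimpleGraph V) (a b : V) : ind G a b ≤ 1 := by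
  unfold ind; split_ifs <;> norm_num

theorem neq_nonneg (a b : V) : 0 ≤ neq a b := by
  unfold neq; split_ifs <;> norm_num

theorem ind_mul_neq (G : SimpleGraph V) (a b : V) : ind G a b * neq a b = ind G a b := by
  by_cases h : a = b
  · subst h; simp [ind_self]
  · simp [neq, h]

/-- Splitting off the coincidences among `x`, `y`, `z` isolates the part of the kernel that counts
genuine paths and triangles. -/
theorem ker3_eq (G : SimpleGraph V) (x y z : V) :
    ker3 G x y z = (2 * (ind G x y * ind G y z * neq x z) - ind G x y * ind G y z * ind G x z) +
      ind G x y * (1 - neq x z) + ind G x y * (1 - neq y z) +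
      (1 - neq x y) * (ind G y z + (1 - neq y z)) := by
  by_cases hxy : x = y
  · subst hxy
    by_cases hxz : x = z
    · subst hxz; simp [ker3, ref, ind, neq]; norm_num
    · by_cases h : G.Adj x z <;> simp [ker3, ref, ind, neq, hxz, h]; norm_num
  · by_cases hyz : y = z
    · subst hyz
      by_cases h : G.Adj x y <;> simp [ker3, ref, ind, neq, hxy, h]; norm_num
    · by_cases hxz : x = z
      · subst hxz
        by_cases h : G.Adj x y <;> simp [ker3, ref, ind, neq, hxy, hyz, h, G.adj_comm y x]; norm_num
      · simp [ker3, ref, neq, hxy, hyz, hxz]; ring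

variable [Fintype V]

theorem sum_ind_eq_degree (G : SimpleGraph V) [DecidableRel G.Adj] (a : V) :
    ∑ b, ind G a b = G.degree a := by
  classical
  have : ∀ b, ind G a b = if b ∈ G.neighborFinset a then 1 else 0 := fun b => by
    by_cases h : G.Adj a b <;> simp [ind, h]
  rw [sum_congr rfl fun b _ => this b, sum_boole, filter_mem_eq_inter, univ_inter,
    G.card_neighborFinset_eq_degree]

theorem sum_mul_one_sub_neq (w f : V → ℝ) (x : V) :
    ∑ z, w z * (f z * (1 - neq x z)) = w x * f x := by
  classical
  have : ∀ z, w z * (f z * (1 - neq x z)) = if x = z then w x * f x else 0 := fun z => by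
    unfold neq; split_ifs with h
    · subst h; ring
    · ring
  simp [this]

/-- The local contribution to the number of four-cycles with a chord. -/
noncomputable def chordSum (G : SimpleGraph V) (a : V) : ℝ :=
  ∑ x, ind G a x * ∑ y, ind G a y * ∑ z, ind G a z *
    (2 * (ind G x y * ind G y z * neq x z) - ind G x y * ind G y z * ind G x z)

/-- The number of labelled edges in the neighbourhood of a vertex. -/
noncomputable def linkEdges (G : SimpleGraph V) (a : V) : ℝ :=
  ∑ x, ind G a x * ∑ y, ind G a y * ind G x y

/-- Distinct triples give `chordSum`, triples with exactly two equal entries give three times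
`linkEdges`, and constant triples give the degree. -/
theorem cubicForm_ind (G : SimpleGraph V) (a : V) :
    cubicForm G (ind G a) = chordSum G a + 3 * linkEdges G a + ∑ x, ind G a x := by
  have h1 : ∀ x y, ∑ z, ind G a z * ker3 G x y z =
      ∑ z, ind G a z * (2 * (ind G x y * ind G y z * neq x z) -
        ind G x y * ind G y z * ind G x z) + ind G a x * ind G x y + ind G a y * ind G x y +
      (∑ z, ind G a z * ind G y z + ind G a y) * (1 - neq x y) := fun x y => by
    simp only [ker3_eq, mul_add, sum_add_distrib, sum_mul_one_sub_neq]
    have h2 : ∑ z, ind G a z * ((1 - neq x y) * ind G y z) =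
        (∑ z, ind G a z * ind G y z) * (1 - neq x y) := by
      rw [sum_mul]; exact sum_congr rfl fun z _ => by ring
    rw [h2]
    ring
  have h3 : ∀ x, ∑ y, ind G a y * ∑ z, ind G a z * ker3 G x y z =
      ∑ y, ind G a y * ∑ z, ind G a z * (2 * (ind G x y * ind G y z * neq x z) -
        ind G x y * ind G y z * ind G x z) +
      ind G a x * ∑ y, ind G a y * ind G x y + ∑ y, ind G a y * ind G x y +
      (ind G a x * ∑ z, ind G a z * ind G x z + ind G a x) := fun x => by
    simp only [h1, mul_add, sum_add_distrib, sum_mul_one_sub_neq]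
    have h2 : ∑ y, ind G a y * (ind G a x * ind G x y) = ind G a x * ∑ y, ind G a y * ind G x y := by
      rw [mul_sum]; exact sum_congr rfl fun z _ => by ring
    have h4 : ∑ y, ind G a y * (ind G a y * ind G x y) = ∑ y, ind G a y * ind G x y := by
      simp only [← mul_assoc, ind_mul_self]
    rw [h2, h4, ind_mul_self]
  simp only [cubicForm, h3, mul_add, sum_add_distrib]
  have h5 : ∀ (x : V) (c : ℝ), ind G a x * (ind G a x * c) = ind G a x * c := fun x c => by
    rw [← mul_assoc, ind_mul_self]
  simp only [h5, ind_mul_self, chordSum, linkEdges]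
  ring

theorem quadraticForm_ind (G : SimpleGraph V) (a : V) :
    quadraticForm G (ind G a) = linkEdges G a + ∑ x, ind G a x := by
  have h1 : ∀ x, ∑ y, ind G a y * ref G x y = ∑ y, ind G a y * ind G x y + ind G a x := fun x => by
    have := sum_mul_one_sub_neq (ind G a) (fun _ => 1) x
    simp only [one_mul, mul_one] at this
    simp only [ref, mul_add, sum_add_distrib, this]
  simp only [quadraticForm, h1, mul_add, sum_add_distrib, ind_mul_self, linkEdges]

theorem sum_linkEdges (G : SimpleGraph V) : ∑ a, linkEdges G a = tri G := by
  simp only [linkEdges, tri, mul_sum]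
  refine sum_congr rfl fun a _ => sum_congr rfl fun b _ => sum_congr rfl fun c _ => by ring

/-- Each labelled four-cycle is counted with weight `p + q - p q`, where `p` and `q` indicate its
two diagonals. This is at most `1`, since `(1 - p) (1 - q) ≥ 0`; four-cycles without chords are
lost. -/
theorem sum_chordSum_le (G : SimpleGraph V) : ∑ a, chordSum G a ≤ quad G := by
  set D : V → V → V → V → ℝ := fun a b c d =>
    ind G a b * ind G a c * ind G a d * (ind G b c * ind G c d * neq b d) with hD
  have h1 : ∑ a, chordSum G a = ∑ a, ∑ b, ∑ c, ∑ d, D a b c d + ∑ a, ∑ b, ∑ c, ∑ d, D b a d c -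
      ∑ a, ∑ b, ∑ c, ∑ d,
        ind G a b * ind G a c * ind G a d * (ind G b c * ind G c d * ind G b d) := by
    have h2 : ∑ a, ∑ b, ∑ c, ∑ d, D b a d c = ∑ a, ∑ b, ∑ c, ∑ d, D a b c d := by
      rw [sum_comm]
      exact sum_congr rfl fun a _ => sum_congr rfl fun b _ => sum_comm
    rw [h2, ← two_mul, mul_sum, ← sum_sub_distrib]
    refine sum_congr rfl fun a _ => ?_
    simp only [chordSum, mul_sum, ← sum_sub_distrib]
    refine sum_congr rfl fun b _ => sum_congr rfl fun c _ => sum_congr rfl fun d _ => ?_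
    simp only [hD]; ring
  rw [h1, quad]
  simp only [← sum_add_distrib, ← sum_sub_distrib]
  refine sum_le_sum fun a _ => sum_le_sum fun b _ => sum_le_sum fun c _ => sum_le_sum fun d _ => ?_
  have e1 := ind_mul_neq G a c
  have e2 := ind_mul_neq G b d
  set f := ind G a b * ind G b c * ind G c d * ind G a d * neq a c * neq b d with hf
  have e3 : D a b c d = f * ind G a c := by
    simp only [hD, hf]
    linear_combination -(ind G a b * ind G a d * (ind G b c * ind G c d * neq b d)) * e1
  have e4 : D b a d c = f * ind G b d := by
    simp only [hD, hf, ind_comm G b a, ind_comm G d c]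
    linear_combination -(ind G a b * ind G b c * ind G a d * ind G c d * neq a c) * e2
  have e5 : ind G a b * ind G a c * ind G a d * (ind G b c * ind G c d * ind G b d) =
      f * (ind G a c * ind G b d) := by
    simp only [hf]
    linear_combination (- (ind G a b * ind G a d * (ind G b c * ind G c d * ind G b d))) * e1 -
      (ind G a b * ind G a d * (ind G b c * ind G c d) * ind G a c * neq a c) * e2
  rw [e3, e4, e5]
  have hf0 : 0 ≤ f := by
    simp only [hf]
    have := ind_nonneg G a b
    have := ind_nonneg G b c
    have := ind_nonneg G c d
    have := ind_nonneg G a d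
    have := neq_nonneg a c
    have := neq_nonneg b d
    positivity
  have h3 : 0 ≤ (1 - ind G a c) * (1 - ind G b d) :=
    mul_nonneg (sub_nonneg.2 (ind_le_one G a c)) (sub_nonneg.2 (ind_le_one G b d))
  have := mul_nonneg hf0 h3
  nlinarith

/-- The lower bound on the number of four-cycles of a regular graph. -/
theorem le_quad_sub_tri (G : SimpleGraph V) [DecidableRel G.Adj] {r : ℕ} (hr : 0 < r)
    (hG : G.IsRegularOfDegree r) (ν c : ℝ)
    (hc : ∀ l ∈ Icc 1 r, c ≤ partCube r l - ν * partSq r l) :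
    c * Fintype.card V ≤ quad G + 3 * tri G + r * Fintype.card V -
      ν * (tri G + r * Fintype.card V) := by
  classical
  have hdeg : ∀ a, ∑ b, ind G a b = r := fun a => by rw [sum_ind_eq_degree, hG a]
  have h1 : ∀ a, c ≤ chordSum G a + 3 * linkEdges G a + r - ν * (linkEdges G a + r) := fun a => by
    have hcast : (fun x => ((if G.Adj a x then 1 else 0 : ℕ) : ℝ)) = ind G a := by
      ext x
      unfold ind
      split_ifs <;> simp
    -- The indicator of the neighbourhood of `a` is an integer weighting of total `r`, by
    -- regularity.
    obtain ⟨l, hl, hle⟩ := exists_partition_le_energy G ν (fun x => if G.Adj a x then 1 else 0)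
      hr (by
        have := hdeg a
        rw [← hcast] at this
        exact_mod_cast (show ∑ b, ((if G.Adj a b then 1 else 0 : ℕ) : ℝ) = r from this))
    rw [hcast, energy, cubicForm_ind, quadraticForm_ind, hdeg] at hle
    exact (hc l hl).trans hle
  have h2 := sum_le_sum fun a (_ : a ∈ univ) => h1 a
  have h3 := sum_chordSum_le G
  simp only [sum_sub_distrib, sum_add_distrib, ← mul_sum, sum_linkEdges, sum_const, card_univ,
    nsmul_eq_mul] at h2
  linarith

/-- Grouped by the path `b - a - d`, four-cycles count common neighbours of `b` and `d`, with `-1`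
discarding `a` itself; triangles add the term `ind G b d`. -/
theorem quad_add_tri (G : SimpleGraph V) : quad G + tri G =
    ∑ a, ∑ b, ∑ d, ind G a b * ind G a d * neq b d *
      (∑ c, ind G b c * ind G c d + ind G b d - 1) := by
  have h1 : quad G = ∑ a, ∑ b, ∑ d, ind G a b * ind G a d * neq b d *
      (∑ c, ind G b c * ind G c d - 1) := by
    rw [quad]
    refine sum_congr rfl fun a _ => sum_congr rfl fun b _ => ?_
    rw [sum_comm]
    refine sum_congr rfl fun d _ => ?_
    have := sum_mul_one_sub_neq (fun c => ind G b c) (fun c => ind G c d) a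
    have h2 : ∑ c, ind G a b * ind G b c * ind G c d * ind G a d * neq a c * neq b d =
        ind G a b * ind G a d * neq b d * (∑ c, ind G b c * ind G c d -
          ∑ c, ind G b c * (ind G c d * (1 - neq a c))) := by
      rw [← sum_sub_distrib, mul_sum]
      exact sum_congr rfl fun c _ => by ring
    rw [h2, this, ind_comm G b a]
    have e1 := ind_mul_self G a b
    have e2 := ind_mul_self G a d
    linear_combination (-ind G a d * ind G a d * neq b d) * e1 - ind G a b * neq b d * e2
  have h2 : tri G = ∑ a, ∑ b, ∑ d, ind G a b * ind G a d * neq b d * ind G b d := by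
    rw [tri]
    refine sum_congr rfl fun a _ => sum_congr rfl fun b _ => sum_congr rfl fun d _ => ?_
    linear_combination (-ind G a b * ind G a d) * ind_mul_neq G b d
  rw [h1, h2]
  simp only [← sum_add_distrib]
  refine sum_congr rfl fun a _ => sum_congr rfl fun b _ => sum_congr rfl fun d _ => by ring

theorem sum_cherries (G : SimpleGraph V) [DecidableRel G.Adj] {r : ℕ}
    (hG : G.IsRegularOfDegree r) :
    ∑ a, ∑ b, ∑ d, ind G a b * ind G a d * neq b d * ((r : ℝ) - 1) =
      Fintype.card V * (r * (r - 1) ^ 2) := by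
  have hdeg : ∀ a, ∑ b, ind G a b = r := fun a => by rw [sum_ind_eq_degree, hG a]
  have h1 : ∀ a b, ∑ d, ind G a b * ind G a d * neq b d * ((r : ℝ) - 1) =
      ind G a b * (r - 1) ^ 2 := fun a b => by
    have h2 := sum_mul_one_sub_neq (ind G a) (fun _ => 1) b
    have h3 : ∑ d, ind G a b * ind G a d * neq b d * ((r : ℝ) - 1) =
        ind G a b * (∑ d, ind G a d - ∑ d, ind G a d * (1 * (1 - neq b d))) * (r - 1) := by
      rw [← sum_sub_distrib, mul_sum, sum_mul]
      exact sum_congr rfl fun d _ => by ring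
    rw [h3, h2, hdeg]
    linear_combination (-(r - 1 : ℝ)) * ind_mul_self G a b
  simp only [h1, ← sum_mul, hdeg, sum_const, card_univ, nsmul_eq_mul]
  ring

/-- The upper bound on the number of four-cycles of a regular graph. -/
theorem quad_add_tri_le (G : SimpleGraph V) [DecidableRel G.Adj] {r : ℕ}
    (hG : G.IsRegularOfDegree r) : quad G + tri G ≤ Fintype.card V * (r * (r - 1) ^ 2) := by
  rw [quad_add_tri, ← sum_cherries G hG]
  refine sum_le_sum fun a _ => sum_le_sum fun b _ => sum_le_sum fun d _ =>
    mul_le_mul_of_nonneg_left ?_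
      (mul_nonneg (mul_nonneg (ind_nonneg _ _ _) (ind_nonneg _ _ _)) (neq_nonneg _ _))
  refine sub_le_sub_right ?_ _
  have hdeg : ∑ c, ind G b c = r := by rw [sum_ind_eq_degree, hG b]
  have h1 := sum_mul_one_sub_neq (ind G b) (fun _ => 1) d
  rw [mul_one] at h1
  -- The edge `bd` is charged to the neighbour `c = d` of `b`, which is no common neighbour; so
  -- every neighbour of `b` is used at most once.
  rw [← hdeg, ← h1, ← sum_add_distrib]
  refine sum_le_sum fun c _ => ?_
  rw [← mul_add]
  refine mul_le_of_le_one_right (ind_nonneg _ _ _) ?_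
  by_cases h : d = c
  · subst h; simp [ind_self, neq]
  · simpa [neq, h] using ind_le_one G c d

theorem tri_nonneg (G : SimpleGraph V) : 0 ≤ tri G :=
  sum_nonneg fun _ _ => sum_nonneg fun _ _ => sum_nonneg fun _ _ =>
    mul_nonneg (mul_nonneg (ind_nonneg _ _ _) (ind_nonneg _ _ _)) (ind_nonneg _ _ _)

theorem tri_le (G : SimpleGraph V) [DecidableRel G.Adj] {r : ℕ} (hG : G.IsRegularOfDegree r) :
    tri G ≤ Fintype.card V * (r * (r - 1)) := by
  have hdeg : ∀ a, ∑ b, ind G a b = r := fun a => by rw [sum_ind_eq_degree, hG a]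
  have h1 : ∀ a, ∑ b, ∑ c, ind G a b * ind G b c * ind G a c ≤ r * (r - 1) := fun a => by
    have h2 : ∀ b, ∑ c, ind G a b * ind G b c * ind G a c ≤ ind G a b * (r - 1) := fun b => by
      have h3 := sum_mul_one_sub_neq (ind G a) (fun _ => 1) b
      have h4 : ind G a b * ((r : ℝ) - 1) = ∑ c, ind G a b * (ind G a c * neq b c) := by
        have : ∑ c, ind G a c * neq b c =
            ∑ c, ind G a c - ∑ c, ind G a c * (1 * (1 - neq b c)) := by
          rw [← sum_sub_distrib]; exact sum_congr rfl fun c _ => by ring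
        rw [← mul_sum, this, h3, hdeg]
        linear_combination ind_mul_self G a b
      rw [h4]
      refine sum_le_sum fun c _ => ?_
      rw [mul_assoc]
      refine mul_le_mul_of_nonneg_left ?_ (ind_nonneg _ _ _)
      rw [mul_comm]
      refine mul_le_mul_of_nonneg_left ?_ (ind_nonneg _ _ _)
      rw [← ind_mul_neq]
      exact mul_le_of_le_one_left (neq_nonneg _ _) (ind_le_one _ _ _)
    refine (sum_le_sum fun b _ => h2 b).trans ?_
    rw [← sum_mul, hdeg]
  refine (sum_le_sum fun a _ => h1 a).trans ?_
  simp

end Bounds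

/-! ### The complete bipartite graph -/

section Bipartite

theorem completeBipartiteGraph_isRegular (r : ℕ) [DecidableRel (completeBipartiteGraph (Fin r) (Fin r)).Adj] :
    (completeBipartiteGraph (Fin r) (Fin r)).IsRegularOfDegree r := by
  intro a
  have h := sum_ind_eq_degree (completeBipartiteGraph (Fin r) (Fin r)) a
  have h2 : ∑ b, ind (completeBipartiteGraph (Fin r) (Fin r)) a b = r := by
    rw [Fintype.sum_sum_type]
    rcases a with a | a <;> simp [ind]
  rw [h2] at h
  exact_mod_cast h.symm

theorem tri_completeBipartiteGraph (r : ℕ) : tri (completeBipartiteGraph (Fin r) (Fin r)) = 0 := by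
  refine sum_eq_zero fun a _ => sum_eq_zero fun b _ => sum_eq_zero fun c _ => ?_
  rcases a with a | a <;> rcases b with b | b <;> rcases c with c | c <;> simp [ind]

theorem quad_completeBipartiteGraph (r : ℕ) :
    quad (completeBipartiteGraph (Fin r) (Fin r)) = 2 * r * (r * (r - 1) ^ 2) := by
  classical
  have h1 := quad_add_tri (completeBipartiteGraph (Fin r) (Fin r))
  have h2 := sum_cherries _ (completeBipartiteGraph_isRegular r)
  rw [tri_completeBipartiteGraph, add_zero] at h1
  have h3 : (Fintype.card (Fin r ⊕ Fin r) : ℝ) = 2 * r := by simp; ring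
  rw [h1, ← h3, ← h2]
  refine sum_congr rfl fun a _ => sum_congr rfl fun b _ => sum_congr rfl fun d _ => ?_
  rw [Fintype.sum_sum_type]
  rcases a with a | a <;> rcases b with b | b <;> rcases d with d | d <;> simp [ind]

end Bipartite

/-! ### The generating points and the inclusion in the polygon -/

section Points

/-- The point of the graphs `C^r_l`. -/
noncomputable def partPoint (r l : ℕ) : ℝ × ℝ :=
  ((partSq r l - r) / 6, (partCube r l - 3 * partSq r l + 2 * r) / 8)

theorem point_eq {V : Type*} [Fintype V] (G : SimpleGraph V) :
    point G = (tri G / (6 * Fintype.card V), quad G / (8 * Fintype.card V)) := by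
  rw [point, density_three, density_four]

variable {r l : ℕ}

theorem point_of_isHypergraphSection {V : Type*} [Fintype V] [Nonempty V] {G : SimpleGraph V}
    (hl : 0 < l) (hG : IsHypergraphSection (equalParts r l) G) : point G = partPoint r l := by
  have hV : (Fintype.card V : ℝ) ≠ 0 := by exact_mod_cast Fintype.card_ne_zero
  have h1 : ∑ i, (equalParts r l i : ℝ) * (equalParts r l i - 1) = partSq r l - r := by
    rw [← partSum_id (r := r) hl, partSq, partSum, partSum, ← sum_sub_distrib]
    exact sum_congr rfl fun i _ => by ring
  have h2 : ∑ i, (equalParts r l i : ℝ) * (equalParts r l i - 1) * (equalParts r l i - 2) =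
      partCube r l - 3 * partSq r l + 2 * r := by
    rw [← partSum_id (r := r) hl, partSq, partCube, partSum, partSum, partSum, mul_sum, mul_sum,
      ← sum_sub_distrib, ← sum_add_distrib]
    exact sum_congr rfl fun i _ => by ring
  rw [point_eq, hG.tri_eq, hG.quad_eq, h1, h2, partPoint, mul_comm 6, mul_comm 8,
    mul_div_mul_left _ _ hV, mul_div_mul_left _ _ hV]

theorem extremeGraphPoints_eq (hl : l ∈ Icc 1 r) : extremeGraphPoints r l = {partPoint r l} := by
  rw [mem_Icc] at hl
  ext p
  constructor
  · rintro ⟨V, _, _, G, hG, rfl⟩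
    exact point_of_isHypergraphSection hl.1 hG
  · rintro rfl
    obtain ⟨V, _, _, G, hG⟩ := exists_isHypergraphSection hl.1 (equalParts r l)
      (equalParts_pos hl.2)
    exact ⟨V, _, ‹_›, G, hG, point_of_isHypergraphSection hl.1 hG⟩

theorem isRegularOfDegree_of_sum_ind {V : Type*} [Fintype V] {G : SimpleGraph V}
    [DecidableRel G.Adj] (h : ∀ a, ∑ b, ind G a b = r) : G.IsRegularOfDegree r := fun a => by
  have := h a
  rw [sum_ind_eq_degree] at this
  exact_mod_cast this

theorem partPoint_mem_regularPoints (hl : l ∈ Icc 1 r) : partPoint r l ∈ regularPoints r := by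
  classical
  have h : partPoint r l ∈ extremeGraphPoints r l := by rw [extremeGraphPoints_eq hl]; rfl
  rw [mem_Icc] at hl
  obtain ⟨V, _, _, G, hG, hp⟩ := h
  refine ⟨V, _, ‹_›, G, inferInstance, isRegularOfDegree_of_sum_ind fun a => ?_, hp⟩
  rw [hG.sum_ind]
  exact_mod_cast sum_equalParts (r := r) hl.1

theorem bipartitePoint_eq (hr : 0 < r) : bipartitePoint r = (0, (r * (r - 1) ^ 2 : ℝ) / 8) := by
  have hr' : (r : ℝ) ≠ 0 := by exact_mod_cast hr.ne'
  rw [bipartitePoint, point_eq, tri_completeBipartiteGraph, quad_completeBipartiteGraph]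
  ext
  · simp
  · simp
    field_simp
    ring

theorem bipartitePoint_mem_regularPoints (hr : 0 < r) : bipartitePoint r ∈ regularPoints r := by
  classical
  exact ⟨Fin r ⊕ Fin r, inferInstance, ⟨Sum.inl ⟨0, hr⟩⟩, completeBipartiteGraph (Fin r) (Fin r),
    inferInstance, completeBipartiteGraph_isRegular r, rfl⟩

/-- The points that span the polygon. -/
noncomputable def generators (r : ℕ) : Set (ℝ × ℝ) :=
  insert (bipartitePoint r) (partPoint r '' (Icc 1 r : Finset ℕ))

theorem polygon_eq (r : ℕ) : polygon r = convexHull ℝ (generators r) := by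
  rw [polygon, generators, Set.insert_eq]
  congr 2
  rw [Set.image_eq_iUnion]
  exact Set.iUnion₂_congr fun l hl => extremeGraphPoints_eq hl

theorem generators_finite (r : ℕ) : (generators r).Finite :=
  ((Icc 1 r).finite_toSet.image _).insert _

theorem generators_subset_regularPoints (hr : 0 < r) : generators r ⊆ regularPoints r := by
  rintro p (rfl | ⟨l, hl, rfl⟩)
  · exact bipartitePoint_mem_regularPoints hr
  · exact partPoint_mem_regularPoints hl

/-- The linear inequalities on the upper boundary. -/
theorem regularPoints_bounds {p : ℝ × ℝ} (hp : p ∈ regularPoints r) :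
    0 ≤ p.1 ∧ 6 * p.1 ≤ r * (r - 1) ∧ 8 * p.2 + 6 * p.1 ≤ r * (r - 1) ^ 2 := by
  obtain ⟨V, _, _, G, _, hG, rfl⟩ := hp
  have hV : (0 : ℝ) < Fintype.card V := by exact_mod_cast Fintype.card_pos
  have h1 := tri_nonneg G
  have h2 := tri_le G hG
  have h3 := quad_add_tri_le G hG
  rw [point_eq]
  have e1 : 6 * (tri G / (6 * Fintype.card V)) = tri G / Fintype.card V := by field_simp
  have e2 : 8 * (quad G / (8 * Fintype.card V)) = quad G / Fintype.card V := by field_simp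
  refine ⟨by positivity, ?_, ?_⟩
  · simp only [e1]
    rw [div_le_iff₀ hV]
    linarith
  · simp only [e1, e2]
    rw [← add_div, div_le_iff₀ hV]
    linarith

/-- The linear inequalities on the lower boundary. -/
theorem regularPoints_lower {p : ℝ × ℝ} (hr : 0 < r) (hp : p ∈ regularPoints r) (κ c : ℝ)
    (hc : ∀ l ∈ Icc 1 r, c ≤ (partPoint r l).2 + κ * (partPoint r l).1) : c ≤ p.2 + κ * p.1 := by
  obtain ⟨V, _, _, G, _, hG, rfl⟩ := hp
  have hV : (0 : ℝ) < Fintype.card V := by exact_mod_cast Fintype.card_pos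
  -- Since `quad = 8 n y` and `tri = 6 n x`, matching the slope requires `6 (3 - ν) = 8 κ`; the
  -- constant absorbs the degree terms.
  have h := le_quad_sub_tri G hr hG (3 - 4 * κ / 3) (8 * c + r - (3 - 4 * κ / 3) * r)
    (fun l hl => by
      have := hc l hl
      simp only [partPoint] at this
      linarith)
  rw [point_eq]
  have e1 : quad G / (8 * Fintype.card V) + κ * (tri G / (6 * Fintype.card V)) =
      (quad G / 8 + κ * tri G / 6) / Fintype.card V := by field_simp
  simp only [e1]
  rw [le_div_iff₀ hV]
  linarith

/-- A point outside is strictly separated by `α x + β y`. For `β > 0` this contradicts a lower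
inequality; for `β ≤ 0` only the segment from `K_{r,r}` to `C^r_1` is needed. -/
theorem regularPoints_subset_polygon (hr : 0 < r) : regularPoints r ⊆ polygon r := by
  intro p hp
  rw [polygon_eq]
  by_contra hnot
  obtain ⟨f, u, hfp, hf⟩ := geometric_hahn_banach_point_closed (convex_convexHull ℝ (generators r))
    ((generators_finite r).isClosed_convexHull (𝕜 := ℝ)) hnot
  have hlin : ∀ q : ℝ × ℝ, f q = f (1, 0) * q.1 + f (0, 1) * q.2 := fun q => by
    have : q = q.1 • ((1, 0) : ℝ × ℝ) + q.2 • ((0, 1) : ℝ × ℝ) := by ext <;> simp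
    conv_lhs => rw [this]
    rw [map_add, map_smul, map_smul, smul_eq_mul, smul_eq_mul, mul_comm, mul_comm q.2]
  have hgen : ∀ q ∈ generators r, u < f (1, 0) * q.1 + f (0, 1) * q.2 := fun q hq => by
    rw [← hlin]
    exact hf q (subset_convexHull ℝ _ hq)
  rw [hlin] at hfp
  set α := f (1, 0)
  set β := f (0, 1)
  rcases lt_or_ge 0 β with hβ | hβ
  · have h := regularPoints_lower hr hp (α / β) (u / β) fun l hl => by
      have := hgen _ (Or.inr ⟨l, hl, rfl⟩)
      rw [div_le_iff₀ hβ, add_mul, mul_right_comm, div_mul_cancel₀ _ hβ.ne']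
      linarith
    rw [div_le_iff₀ hβ, add_mul, mul_right_comm, div_mul_cancel₀ _ hβ.ne'] at h
    linarith
  · obtain ⟨h1, h2, h3⟩ := regularPoints_bounds hp
    have hK := hgen _ (Or.inl rfl)
    have h1r : (1 : ℕ) ∈ Icc 1 r := by rw [mem_Icc]; omega
    have hC := hgen _ (Or.inr ⟨1, h1r, rfl⟩)
    have hsq : partSq r 1 = r ^ 2 := by simp [partSq, partSum, equalParts]
    have hcube : partCube r 1 = r ^ 3 := by simp [partCube, partSum, equalParts]
    rw [bipartitePoint_eq hr] at hK
    simp only [partPoint, hsq, hcube] at hC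
    have h4 : β * (r * (r - 1) ^ 2) ≤ β * (8 * p.2 + 6 * p.1) :=
      mul_le_mul_of_nonpos_left h3 hβ
    rcases Nat.lt_or_ge 1 r with hr1 | hr1
    · have hX : (0 : ℝ) < r * (r - 1) := by
        have : (1 : ℝ) < r := by exact_mod_cast hr1
        have : (0 : ℝ) < r := by linarith
        nlinarith
      -- The point of the upper segment above `p` has barycentric weights proportional to `r (r-1) -
      -- 6 x` and `6 x`; as `β ≤ 0`, its value is at most that of `p`.
      have h5 : u * (r * (r - 1)) < (α * p.1 + β * p.2) * (r * (r - 1)) := by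
        have e1 := mul_le_mul_of_nonneg_left hK.le (sub_nonneg.2 h2)
        have e2 := mul_le_mul_of_nonneg_left hC.le (by linarith : 0 ≤ 6 * p.1)
        have e3 := mul_le_mul_of_nonneg_right h4 hX.le
        rcases h1.eq_or_lt with h0 | h0
        · have e4 := mul_lt_mul_of_pos_right hK hX
          rw [← h0] at e3 ⊢
          nlinarith
        · have e4 := mul_lt_mul_of_pos_left hC (by linarith : 0 < 6 * p.1)
          nlinarith
      have := lt_of_mul_lt_mul_right h5 hX.le
      linarith
    -- Here the segment degenerates: both of its ends have first coordinate `0`.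
    · obtain rfl : r = 1 := by omega
      norm_num at h2 h3 hK h4
      have : p.1 = 0 := by linarith
      rw [this] at h4 hfp
      linarith

end Points

/-! ### Disjoint unions and rational convexity -/

section Union

open SimpleGraph

variable {V W : Type*}

theorem ind_sum_inl (G : SimpleGraph V) (H : SimpleGraph W) (a b : V) :
    ind (G ⊕g H) (Sum.inl a) (Sum.inl b) = ind G a b := by
  by_cases h : G.Adj a b <;> simp [ind, h]

theorem ind_sum_inr (G : SimpleGraph V) (H : SimpleGraph W) (a b : W) :
    ind (G ⊕g H) (Sum.inr a) (Sum.inr b) = ind H a b := by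
  by_cases h : H.Adj a b <;> simp [ind, h]

theorem ind_sum_inl_inr (G : SimpleGraph V) (H : SimpleGraph W) (a : V) (b : W) :
    ind (G ⊕g H) (Sum.inl a) (Sum.inr b) = 0 := by simp [ind]

theorem ind_sum_inr_inl (G : SimpleGraph V) (H : SimpleGraph W) (a : W) (b : V) :
    ind (G ⊕g H) (Sum.inr a) (Sum.inl b) = 0 := by simp [ind]

theorem neq_inl (a b : V) : neq (Sum.inl a : V ⊕ W) (Sum.inl b) = neq a b := by
  by_cases h : a = b <;> simp [neq, h]

theorem neq_inr (a b : W) : neq (Sum.inr a : V ⊕ W) (Sum.inr b) = neq a b := by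
  by_cases h : a = b <;> simp [neq, h]

variable [Fintype V] [Fintype W]

theorem tri_sum (G : SimpleGraph V) (H : SimpleGraph W) : tri (G ⊕g H) = tri G + tri H := by
  simp only [tri, Fintype.sum_sum_type, ind_sum_inl, ind_sum_inr, ind_sum_inl_inr, ind_sum_inr_inl,
    zero_mul, mul_zero, sum_const_zero, add_zero, zero_add]

theorem quad_sum (G : SimpleGraph V) (H : SimpleGraph W) : quad (G ⊕g H) = quad G + quad H := by
  simp only [quad, Fintype.sum_sum_type, ind_sum_inl, ind_sum_inr, ind_sum_inl_inr, ind_sum_inr_inl,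
    zero_mul, mul_zero, sum_const_zero, add_zero, zero_add, neq_inl, neq_inr]

/-- There is an `r`-regular graph with `n` vertices, `t` labelled triangles and `q` labelled
four-cycles. -/
def Realizes (r n : ℕ) (t q : ℝ) : Prop :=
  ∃ (V : Type) (_ : Fintype V) (_ : Nonempty V) (G : SimpleGraph V),
    (∀ a, ∑ b, ind G a b = r) ∧ Fintype.card V = n ∧ tri G = t ∧ quad G = q

variable {r : ℕ}

theorem Realizes.pos {n : ℕ} {t q : ℝ} (h : Realizes r n t q) : 0 < n := by
  obtain ⟨V, _, _, G, -, rfl, -⟩ := h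
  exact Fintype.card_pos

theorem Realizes.add {n m : ℕ} {t q t' q' : ℝ} (h : Realizes r n t q) (h' : Realizes r m t' q') :
    Realizes r (n + m) (t + t') (q + q') := by
  obtain ⟨V, _, _, G, hG, rfl, rfl, rfl⟩ := h
  obtain ⟨W, _, _, H, hH, rfl, rfl, rfl⟩ := h'
  refine ⟨V ⊕ W, inferInstance, inferInstance, G ⊕g H, ?_, Fintype.card_sum, tri_sum G H,
    quad_sum G H⟩
  rintro (a | a)
  · simpa [Fintype.sum_sum_type, ind_sum_inl, ind_sum_inl_inr] using hG a
  · simpa [Fintype.sum_sum_type, ind_sum_inr, ind_sum_inr_inl] using hH a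

theorem Realizes.mul {n : ℕ} {t q : ℝ} (h : Realizes r n t q) {k : ℕ} (hk : 0 < k) :
    Realizes r (k * n) (k * t) (k * q) := by
  induction k, hk using Nat.le_induction with
  | base => simpa using h
  | succ k _ ih =>
    have := ih.add h
    push_cast
    simpa only [add_mul, one_mul] using this

theorem mem_regularPoints_iff {p : ℝ × ℝ} :
    p ∈ regularPoints r ↔ ∃ n t q, Realizes r n t q ∧ p = (t / (6 * n), q / (8 * n)) := by
  classical
  constructor
  · rintro ⟨V, _, _, G, _, hG, rfl⟩
    exact ⟨_, _, _, ⟨V, _, ‹_›, G, fun a => by rw [sum_ind_eq_degree, hG a], rfl, rfl, rfl⟩,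
      point_eq G⟩
  · rintro ⟨n, t, q, ⟨V, _, _, G, hG, rfl, rfl, rfl⟩, rfl⟩
    exact ⟨V, _, ‹_›, G, inferInstance, isRegularOfDegree_of_sum_ind hG, point_eq G⟩

/-- Disjoint unions of copies realise all rational convex combinations. -/
theorem convex_regularPoints : Convex ℚ (regularPoints r) := by
  intro p hp p' hp' a b ha hb hab
  rcases ha.eq_or_lt with rfl | ha
  · rw [zero_add] at hab
    simpa [hab] using hp'
  rcases hb.eq_or_lt with rfl | hb
  · rw [add_zero] at hab
    simpa [hab] using hp
  rw [mem_regularPoints_iff] at hp hp' ⊢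
  obtain ⟨n, t, q, h, rfl⟩ := hp
  obtain ⟨n', t', q', h', rfl⟩ := hp'
  obtain ⟨i, hi⟩ : ∃ i : ℕ, (i : ℤ) = a.num := ⟨a.num.toNat, Int.toNat_of_nonneg (Rat.num_nonneg.2 ha.le)⟩
  obtain ⟨j, hj⟩ : ∃ j : ℕ, (j : ℤ) = b.num := ⟨b.num.toNat, Int.toNat_of_nonneg (Rat.num_nonneg.2 hb.le)⟩
  have hi0 : 0 < i := by have := Rat.num_pos.2 ha; omega
  have hj0 : 0 < j := by have := Rat.num_pos.2 hb; omega
  have hn := h.pos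
  have hn' := h'.pos
  have hda := a.den_pos
  have hdb := b.den_pos
  -- The factors `n'` and `n` equalise the sizes, so the vertices split in the ratio `i * b.den : j
  -- * a.den`, which is `a : b`.
  refine ⟨_, _, _, (h.mul (k := i * b.den * n') (by positivity)).add
    (h'.mul (k := j * a.den * n) (by positivity)), ?_⟩
  have hai : (a : ℝ) = i / a.den := by
    conv_lhs => rw [← Rat.num_div_den a, ← hi]
    push_cast
    rfl
  have hbj : (b : ℝ) = j / b.den := by
    conv_lhs => rw [← Rat.num_div_den b, ← hj]
    push_cast
    rfl
  have hab' : (a : ℝ) + b = 1 := by exact_mod_cast hab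
  have hn0 : (n : ℝ) ≠ 0 := by exact_mod_cast hn.ne'
  have hn0' : (n' : ℝ) ≠ 0 := by exact_mod_cast hn'.ne'
  have hda0 : (a.den : ℝ) ≠ 0 := by exact_mod_cast hda.ne'
  have hdb0 : (b.den : ℝ) ≠ 0 := by exact_mod_cast hdb.ne'
  rw [hai, hbj, div_add_div _ _ hda0 hdb0, div_eq_one_iff_eq (mul_ne_zero hda0 hdb0)] at hab'
  have hden : (((i * b.den * n' * n + j * a.den * n * n' : ℕ) : ℝ)) =
      a.den * b.den * (n * n') := by
    push_cast
    rw [← hab']; ring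
  ext
  · simp only [Prod.fst_add, Prod.smul_fst, Rat.smul_def, hai, hbj, hden]
    push_cast
    field_simp
  · simp only [Prod.snd_add, Prod.smul_snd, Rat.smul_def, hai, hbj, hden]
    push_cast
    field_simp

end Union

/-! ### Rational points of the hull, and the closure -/

section RationalHull

/-- A point of the plane with rational coordinates. -/
def IsRationalPoint (p : ℝ × ℝ) : Prop := ∃ a b : ℚ, p = ((a : ℝ), (b : ℝ))

theorem isRationalPoint_of_mem_regularPoints {r : ℕ} {p : ℝ × ℝ} (hp : p ∈ regularPoints r) :
    IsRationalPoint p := by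
  obtain ⟨V, _, _, G, _, hG, rfl⟩ := hp
  refine ⟨(G.copyCount (SimpleGraph.cycleGraph 3) : ℚ) / (Fintype.card V : ℚ),
    (G.copyCount (SimpleGraph.cycleGraph 4) : ℚ) / (Fintype.card V : ℚ), ?_⟩
  simp [point, density]

/-- A rational point in the convex hull of rational points is a rational convex combination. -/
theorem mem_convexHull_rat {S : Set (ℝ × ℝ)} (hS : ∀ p ∈ S, IsRationalPoint p) {p : ℝ × ℝ}
    (hp : IsRationalPoint p) (h : p ∈ convexHull ℝ S) : p ∈ convexHull ℚ S := by
  obtain ⟨ι, _, z, w, hz, hind, hw, hsum, hp'⟩ := eq_pos_convex_span_of_mem_convexHull h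
  -- A `ℚ`-linear retraction of `ℝ` onto `ℚ` sends the real weights to rational ones with the same
  -- sum and barycentre, because all coordinates are rational.
  obtain ⟨π, hπ⟩ := LinearMap.exists_leftInverse_of_injective (Algebra.linearMap ℚ ℝ)
    (LinearMap.ker_eq_bot.2 (algebraMap ℚ ℝ).injective)
  have hπq : ∀ c : ℚ, π (c : ℝ) = c := fun c => by
    have := congrArg (fun f : ℚ →ₗ[ℚ] ℚ => f c) hπ
    simpa using this
  have hπmul : ∀ (x : ℝ) (c : ℚ), π (x * c) = π x * c := fun x c => by
    have : x * (c : ℝ) = c • x := by rw [Rat.smul_def, mul_comm]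
    rw [this, map_smul, smul_eq_mul, mul_comm]
  choose x y hxy using fun i => hS (z i) (hz ⟨i, rfl⟩)
  obtain ⟨a, b, rfl⟩ := hp
  have h1 : ∑ i, w i * (x i : ℝ) = a := by
    have := congrArg Prod.fst hp'
    simpa [Prod.fst_sum, hxy] using this
  have h2 : ∑ i, w i * (y i : ℝ) = b := by
    have := congrArg Prod.snd hp'
    simpa [Prod.snd_sum, hxy] using this
  have h0' : ∑ i, π (w i) = 1 := by
    rw [← map_sum, hsum]; exact_mod_cast hπq 1
  have h1' : ∑ i, π (w i) * x i = a := by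
    rw [← hπq a, ← h1, map_sum]
    exact sum_congr rfl fun i _ => (hπmul _ _).symm
  have h2' : ∑ i, π (w i) * y i = b := by
    rw [← hπq b, ← h2, map_sum]
    exact sum_congr rfl fun i _ => (hπmul _ _).symm
  have h0r : ∑ i, (π (w i) : ℝ) = 1 := by exact_mod_cast h0'
  have h1r : ∑ i, (π (w i) : ℝ) * x i = a := by exact_mod_cast h1'
  have h2r : ∑ i, (π (w i) : ℝ) * y i = b := by exact_mod_cast h2'
  -- Carathéodory's points are affinely independent, so weights are unique: the original ones were
  -- rational, and positivity carries over.
  have heq : ∀ i, (π (w i) : ℝ) = w i := by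
    rw [affineIndependent_iff] at hind
    have := hind univ (fun i => (π (w i) : ℝ) - w i) (by rw [sum_sub_distrib, h0r, hsum, sub_self])
      (by
        ext
        · simp [Prod.fst_sum, hxy, sub_mul, sum_sub_distrib, h1, h1r]
        · simp [Prod.snd_sum, hxy, sub_mul, sum_sub_distrib, h2, h2r])
    exact fun i => sub_eq_zero.1 (this i (mem_univ i))
  have hpos : ∀ i, 0 ≤ π (w i) := fun i => by
    have := hw i
    rw [← heq i] at this
    exact_mod_cast this.le
  have hmem := (convex_convexHull ℚ S).sum_mem (t := univ) (w := fun i => π (w i)) (z := z)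
    (fun i _ => hpos i) h0' (fun i _ => subset_convexHull ℚ S (hz ⟨i, rfl⟩))
  convert hmem using 1
  ext
  · simp [Prod.fst_sum, hxy, Rat.smul_def, h1r]
  · simp [Prod.snd_sum, hxy, Rat.smul_def, h2r]

variable {r : ℕ}

theorem regularPoints_eq (hr : 0 < r) :
    regularPoints r = {p | p ∈ polygon r ∧ ∃ a b : ℚ, p = ((a : ℝ), (b : ℝ))} := by
  ext p
  constructor
  · exact fun hp => ⟨regularPoints_subset_polygon hr hp, isRationalPoint_of_mem_regularPoints hp⟩
  · rintro ⟨hp, hrat⟩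
    rw [polygon_eq] at hp
    have hgen := generators_subset_regularPoints hr
    exact convexHull_min hgen convex_regularPoints
      (mem_convexHull_rat (fun q hq => isRationalPoint_of_mem_regularPoints (hgen hq)) hrat hp)

/-- Rational parameters are dense in the unit interval, so real segments between points of `S` lie
in the closure; continuity in the end points does the rest. -/
theorem convex_closure_of_rat {S : Set (ℝ × ℝ)} (hS : Convex ℚ S) : Convex ℝ (closure S) := by
  have hseg : ∀ p ∈ S, ∀ q ∈ S, ∀ t ∈ Set.Icc (0 : ℝ) 1, (1 - t) • p + t • q ∈ closure S := by
    intro p hp q hq t ht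
    have hdense : Set.Icc (0 : ℝ) 1 ⊆
        closure (Set.Ioo (0 : ℝ) 1 ∩ Set.range ((↑) : ℚ → ℝ)) := by
      rw [← closure_Ioo zero_ne_one]
      exact closure_minimal (Rat.denseRange_cast.open_subset_closure_inter isOpen_Ioo)
        isClosed_closure
    have hcont : Continuous fun t : ℝ => (1 - t) • p + t • q := by fun_prop
    refine map_mem_closure (f := fun t : ℝ => (1 - t) • p + t • q) hcont (hdense ht) ?_
    rintro _ ⟨⟨h0, h1⟩, c, rfl⟩
    have h0' : 0 ≤ c := by exact_mod_cast h0.le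
    have h1' : 0 ≤ 1 - c := by
      have : c ≤ 1 := by exact_mod_cast h1.le
      linarith
    have := hS hp hq h1' h0' (by ring)
    convert this using 1
    ext <;> simp [Rat.smul_def]
  intro p hp q hq a b ha hb hab
  have hcont : Continuous (Function.uncurry fun x y : ℝ × ℝ => (1 - b) • x + b • y) := by
    unfold Function.uncurry
    fun_prop
  have := map_mem_closure₂ hcont hp hq
    (fun x hx y hy => hseg x hx y hy b ⟨hb, by linarith⟩)
  rw [closure_closure] at this
  rwa [← hab, add_sub_cancel_right] at this

theorem closure_regularPoints (hr : 0 < r) : closure (regularPoints r) = polygon r := by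
  refine Set.Subset.antisymm (closure_minimal (regularPoints_subset_polygon hr) ?_) ?_
  · rw [polygon_eq]
    exact (generators_finite r).isClosed_convexHull (𝕜 := ℝ)
  · rw [polygon_eq]
    exact convexHull_min ((generators_subset_regularPoints hr).trans subset_closure)
      (convex_closure_of_rat convex_regularPoints)

end RationalHull

/-! ### The vertices of the polygon -/

section Extreme

/-- A point of `S` at which a pair of linear functionals is uniquely lexicographically minimal is an
extreme point of the convex hull. -/
theorem mem_extremePoints_of_lex {E : Type*} [AddCommGroup E] [Module ℝ E] {S : Set E} {p : E}
    (hp : p ∈ S) (f g : E →ₗ[ℝ] ℝ) (h : ∀ q ∈ S, q ≠ p → f p < f q ∨ (f p = f q ∧ g p < g q)) :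
    p ∈ (convexHull ℝ S).extremePoints ℝ := by
  -- This set is a lexicographic half-space with apex `p`; it contains the hull, and `p` is not
  -- interior to any segment in it.
  have hconv : Convex ℝ {q | q = p ∨ f p < f q ∨ (f p = f q ∧ g p < g q)} := by
    intro x hx y hy a b ha hb hab
    rcases ha.eq_or_lt with rfl | ha
    · rw [zero_add] at hab
      simpa [hab] using hy
    rcases hb.eq_or_lt with rfl | hb
    · rw [add_zero] at hab
      simpa [hab] using hx
    have hfp : f p = a * f p + b * f p := by rw [← add_mul, hab, one_mul]
    have hgp : g p = a * g p + b * g p := by rw [← add_mul, hab, one_mul]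
    have hf : f (a • x + b • y) = a * f x + b * f y := by simp
    have hg : g (a • x + b • y) = a * g x + b * g y := by simp
    simp only [Set.mem_ofPred_eq] at hx hy ⊢
    rw [hf, hg]
    rcases hx with rfl | hx | ⟨hx, hx'⟩ <;> rcases hy with rfl | hy | ⟨hy, hy'⟩
    · left; rw [← add_smul, hab, one_smul]
    · right; left; nlinarith [mul_lt_mul_of_pos_left hy hb]
    · right; right
      refine ⟨by rw [← hy]; exact hfp, by nlinarith [mul_lt_mul_of_pos_left hy' hb]⟩
    · right; left; nlinarith [mul_lt_mul_of_pos_left hx ha]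
    · right; left; nlinarith [mul_lt_mul_of_pos_left hx ha, mul_lt_mul_of_pos_left hy hb]
    · right; left; rw [← hy]; nlinarith [mul_lt_mul_of_pos_left hx ha]
    · right; right
      refine ⟨by rw [← hx]; exact hfp, by nlinarith [mul_lt_mul_of_pos_left hx' ha]⟩
    · right; left; rw [← hx]; nlinarith [mul_lt_mul_of_pos_left hy hb]
    · right; right
      refine ⟨by rw [← hx, ← hy]; exact hfp,
        by nlinarith [mul_lt_mul_of_pos_left hx' ha, mul_lt_mul_of_pos_left hy' hb]⟩
  have hsub : convexHull ℝ S ⊆ {q | q = p ∨ f p < f q ∨ (f p = f q ∧ g p < g q)} :=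
    convexHull_min (fun q hq => or_iff_not_imp_left.2 (h q hq)) hconv
  refine ⟨subset_convexHull ℝ S hp, fun x hx y hy hxy => ?_⟩
  obtain ⟨a, b, ha, hb, hab, hpe⟩ := hxy
  by_contra hne
  have hx' := (hsub hx).resolve_left hne
  have hfp : f p = a * f p + b * f p := by rw [← add_mul, hab, one_mul]
  have hgp : g p = a * g p + b * g p := by rw [← add_mul, hab, one_mul]
  have hf : f p = a * f x + b * f y := by rw [← hpe]; simp
  have hg : g p = a * g x + b * g y := by rw [← hpe]; simp
  have hfy : f p ≤ f y := by
    rcases hsub hy with rfl | hy | ⟨hy, -⟩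
    exacts [le_rfl, hy.le, hy.le]
  have h1 := mul_le_mul_of_nonneg_left hfy hb.le
  rcases hx' with hx' | ⟨hx', hx''⟩
  · have := mul_lt_mul_of_pos_left hx' ha
    linarith
  · have h2 := mul_lt_mul_of_pos_left hx'' ha
    rcases hsub hy with rfl | hy | ⟨-, hy⟩
    · linarith
    · have := mul_lt_mul_of_pos_left hy hb
      rw [← hx'] at hf
      linarith
    · have := mul_lt_mul_of_pos_left hy hb
      linarith

variable {r l q : ℕ}

theorem partSq_of_mem_interval (hl : 0 < l) (h1 : q * l ≤ r) (h2 : r ≤ (q + 1) * l) :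
    partSq r l = r * (2 * q + 1) - l * (q * (q + 1)) := by
  rw [partSq, partSum_of_mem_interval hl h1 h2]
  push_cast
  ring

/-- Each part satisfies `n (n-q) (n-q-1) = 0`, so these points lie on one line of slope determined
by `q`. -/
theorem partCube_of_mem_interval (hl : 0 < l) (h1 : q * l ≤ r) (h2 : r ≤ (q + 1) * l) :
    partCube r l = (2 * q + 1) * partSq r l - q * (q + 1) * r := by
  rw [partCube, partSq, partSum_of_mem_interval hl h1 h2, partSum_of_mem_interval hl h1 h2]
  push_cast
  ring

theorem consecutive_mul_nonneg (n q : ℕ) : 0 ≤ ((n : ℝ) - q) * (n - q - 1) := by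
  rcases Nat.lt_or_ge q n with h | h
  · have : (q : ℝ) + 1 ≤ n := by exact_mod_cast h
    exact mul_nonneg (by linarith) (by linarith)
  · have : (n : ℝ) ≤ q := by exact_mod_cast h
    exact mul_nonneg_of_nonpos_of_nonpos (by linarith) (by linarith)

/-- No natural number lies strictly between `q` and `q + 1`, so `(n-q) (n-q-1) ≥ 0` can be summed
over the parts. -/
theorem le_partSq (hl : 0 < l) (q : ℕ) : r * (2 * q + 1) - l * (q * (q + 1)) ≤ partSq r l := by
  have h : partSq r l - (r * (2 * q + 1) - l * (q * (q + 1))) =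
      partSum r l (fun n => ((n : ℝ) - q) * (n - q - 1)) := by
    have h1 := partSum_id (r := r) hl
    have h2 : (l : ℝ) = ∑ i : Fin l, 1 := by simp
    rw [← h1, partSq, partSum, partSum, partSum]
    conv_lhs => rw [h2]
    rw [sum_mul, sum_mul, ← sum_sub_distrib, ← sum_sub_distrib]
    exact sum_congr rfl fun i _ => by ring
  have : 0 ≤ partSum r l (fun n => ((n : ℝ) - q) * (n - q - 1)) :=
    sum_nonneg fun i _ => consecutive_mul_nonneg _ _
  linarith

theorem div_mul_le_and_le (hl : 0 < l) : r / l * l ≤ r ∧ r ≤ (r / l + 1) * l := by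
  have h1 := Nat.div_add_mod r l
  have h2 := Nat.mod_lt r hl
  rw [add_mul, mul_comm (r / l)]
  constructor <;> omega

theorem partSq_lt {m : ℕ} (hl : 0 < l) (hlm : l < m) (hm : m ≤ r) : partSq r m < partSq r l := by
  -- The bound with `q = r / m` is tight at `m` and strictly decreasing in the number of parts,
  -- because `q ≥ 1`.
  obtain ⟨h1, h2⟩ := div_mul_le_and_le (r := r) (hl.trans hlm)
  rw [partSq_of_mem_interval (hl.trans hlm) h1 h2]
  refine lt_of_lt_of_le ?_ (le_partSq hl (r / m))
  have hq : 1 ≤ r / m := (Nat.one_le_div_iff (hl.trans hlm)).2 hm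
  have hq' : (1 : ℝ) ≤ (r / m : ℕ) := by exact_mod_cast hq
  have hlm' : (l : ℝ) < m := by exact_mod_cast hlm
  have := mul_lt_mul_of_pos_right hlm'
    (by positivity : (0 : ℝ) < (r / m : ℕ) * ((r / m : ℕ) + 1))
  linarith

theorem partCube_gt (hl : l ∈ Icc 1 r) (hq : ¬ (q * l ≤ r ∧ r ≤ (q + 1) * l)) :
    (2 * q + 1) * partSq r l - q * (q + 1) * r < partCube r l := by
  rw [mem_Icc] at hl
  have h : partCube r l - ((2 * q + 1) * partSq r l - q * (q + 1) * r) =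
      partSum r l (fun n => n * (((n : ℝ) - q) * (n - q - 1))) := by
    have h1 := partSum_id (r := r) hl.1
    rw [← h1, partSq, partCube, partSum, partSum, partSum, partSum, mul_sum, mul_sum,
      ← sum_sub_distrib, ← sum_sub_distrib]
    exact sum_congr rfl fun i _ => by ring
  have hnn : ∀ n : ℕ, (0 : ℝ) ≤ n * (((n : ℝ) - q) * (n - q - 1)) := fun n =>
    mul_nonneg n.cast_nonneg (consecutive_mul_nonneg n q)
  have hpos : ∀ n : ℕ, 0 < n → n ≠ q → n ≠ q + 1 → (0 : ℝ) < n * (((n : ℝ) - q) * (n - q - 1)) :=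
    fun n h0 h1 h2 => (hnn n).lt_of_ne' (mul_ne_zero (by exact_mod_cast h0.ne')
      (mul_ne_zero (sub_ne_zero.2 (by exact_mod_cast h1)) (by
        rw [sub_sub]; exact sub_ne_zero.2 (by exact_mod_cast h2))))
  have hp : 0 < r / l := Nat.div_pos hl.2 hl.1
  have hmod := Nat.mod_lt r hl.1
  have hdm := Nat.div_add_mod r l
  have hw : (0 : ℝ) < l - (r % l : ℕ) := sub_pos.2 (by exact_mod_cast hmod)
  have key : 0 < partSum r l (fun n => n * (((n : ℝ) - q) * (n - q - 1))) := by
    rw [partSum_eq r l hl.1]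
    -- This is the case where all parts are `q` or `q + 1`; otherwise a part outside that pair
    -- occurs and contributes strictly.
    by_cases hcase : r / l = q ∨ (r / l = q + 1 ∧ r % l = 0)
    · exfalso
      apply hq
      rcases hcase with h1 | ⟨h1, h2⟩
      · rw [← h1]; exact div_mul_le_and_le hl.1
      · rw [h1, h2] at hdm
        rw [add_mul]
        constructor <;> nlinarith
    · push Not at hcase
      by_cases h1 : r / l = q + 1
      · have h2 : 0 < r % l := Nat.pos_of_ne_zero (hcase.2 h1)
        have h3 : (0 : ℝ) < (r % l : ℕ) := by exact_mod_cast h2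
        refine add_pos_of_nonneg_of_pos (mul_nonneg hw.le (hnn _)) (mul_pos h3
          (hpos (r / l + 1) (by omega) (by omega) (by omega)) |>.trans_eq ?_)
        push_cast
        ring
      · exact add_pos_of_pos_of_nonneg (mul_pos hw (hpos _ hp hcase.1 h1))
          (mul_nonneg (Nat.cast_nonneg _) (by exact_mod_cast hnn (r / l + 1)))
  linarith

theorem partPoint_fst_lt {m : ℕ} (hl : 0 < l) (hlm : l < m) (hm : m ≤ r) :
    (partPoint r m).1 < (partPoint r l).1 := by
  have := partSq_lt hl hlm hm
  simp only [partPoint]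
  linarith

theorem partPoint_injOn (r : ℕ) : Set.InjOn (partPoint r) (Icc 1 r : Finset ℕ) := by
  intro l hl m hm h
  simp only [coe_Icc, Set.mem_Icc] at hl hm
  rcases lt_trichotomy l m with hlm | hlm | hlm
  · exact absurd (congrArg Prod.fst h) (partPoint_fst_lt hl.1 hlm hm.2).ne'
  · exact hlm
  · exact absurd (congrArg Prod.fst h) (partPoint_fst_lt hm.1 hlm hl.2).ne

theorem partPoint_self (hr : 0 < r) : partPoint r r = 0 := by
  have h1 : partSq r r = r := by
    rw [partSq_of_mem_interval (q := 1) hr (by omega) (by omega)]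
    push_cast; ring
  have h2 : partCube r r = r := by
    rw [partCube_of_mem_interval (q := 1) hr (by omega) (by omega), h1]
    push_cast; ring
  simp only [partPoint, h1, h2]
  ext
  · simp
  · simp; ring

/-- The linear functional `(x, y) ↦ a x + b y`. -/
noncomputable def planeFunctional (a b : ℝ) : ℝ × ℝ →ₗ[ℝ] ℝ :=
  a • LinearMap.fst ℝ ℝ ℝ + b • LinearMap.snd ℝ ℝ ℝ

theorem planeFunctional_apply (a b : ℝ) (p : ℝ × ℝ) :
    planeFunctional a b p = a * p.1 + b * p.2 := by
  simp [planeFunctional]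

theorem planeFunctional_partPoint (r l : ℕ) (ν : ℝ) :
    planeFunctional (6 * (3 - ν)) 8 (partPoint r l) = partCube r l - ν * partSq r l - r + ν * r := by
  rw [planeFunctional_apply, partPoint]
  ring

theorem bipartitePoint_snd_pos (hr : 3 ≤ r) : 0 < (r * (r - 1) ^ 2 : ℝ) / 8 := by
  have : (3 : ℝ) ≤ r := by exact_mod_cast hr
  have : (0 : ℝ) < r := by linarith
  have : (0 : ℝ) < r - 1 := by linarith
  positivity

theorem bipartitePoint_lex (hr : 3 ≤ r) (hl : l ∈ Icc 1 r) :
    8 * (partPoint r l).2 + 6 * (partPoint r l).1 < r * (r - 1) ^ 2 ∨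
      8 * (partPoint r l).2 + 6 * (partPoint r l).1 = r * (r - 1) ^ 2 ∧ 0 < (partPoint r l).1 := by
  have hb := (regularPoints_bounds (partPoint_mem_regularPoints hl)).2.2
  rw [mem_Icc] at hl
  have hself := partPoint_self (r := r) (by omega)
  rcases hl.2.lt_or_eq with h | rfl
  · have h1 := partPoint_fst_lt hl.1 h le_rfl
    rw [hself] at h1
    rcases hb.lt_or_eq with h2 | h2
    · exact Or.inl h2
    · exact Or.inr ⟨h2, h1⟩
  · left
    rw [hself]
    have := bipartitePoint_snd_pos hr
    simp only [Prod.fst_zero, Prod.snd_zero]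
    linarith

theorem bipartitePoint_ne_partPoint (hr : 3 ≤ r) (hl : l ∈ Icc 1 r) :
    bipartitePoint r ≠ partPoint r l := by
  intro h
  have h1 := bipartitePoint_lex hr hl
  rw [← h, bipartitePoint_eq (by omega)] at h1
  simp only at h1
  rcases h1 with h1 | ⟨-, h1⟩ <;> linarith

theorem bipartitePoint_mem_extremePoints (hr : 3 ≤ r) :
    bipartitePoint r ∈ (polygon r).extremePoints ℝ := by
  rw [polygon_eq]
  refine mem_extremePoints_of_lex (Or.inl rfl) (planeFunctional (-6) (-8)) (planeFunctional 1 0) ?_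
  rintro q (rfl | ⟨l, hl, rfl⟩) hne
  · exact absurd rfl hne
  · have h := bipartitePoint_lex hr hl
    rw [bipartitePoint_eq (by omega)]
    simp only [planeFunctional_apply]
    rcases h with h | ⟨h, h'⟩
    · left; linarith
    · right; constructor <;> linarith

/-- The supporting line of slope parameter `2 q + 1` cuts out the face of index `q`; the functional
`s x` then selects an end of it, the sign of `s` deciding which. -/
theorem partPoint_mem_extremePoints_of (hr : 3 ≤ r) (hl : l ∈ Icc 1 r) (h1 : q * l ≤ r)
    (h2 : r ≤ (q + 1) * l) (s : ℝ)
    (hs : ∀ m ∈ Icc 1 r, m ≠ l → q * m ≤ r → r ≤ (q + 1) * m →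
      s * (partPoint r l).1 < s * (partPoint r m).1) :
    partPoint r l ∈ (polygon r).extremePoints ℝ := by
  rw [polygon_eq]
  have hle : ∀ m ∈ Icc 1 r, partCube r l - (2 * q + 1) * partSq r l ≤
      partCube r m - (2 * q + 1) * partSq r m := fun m hm => by
    rw [partCube_of_mem_interval (mem_Icc.1 hl).1 h1 h2]
    by_cases hq : q * m ≤ r ∧ r ≤ (q + 1) * m
    · rw [partCube_of_mem_interval (mem_Icc.1 hm).1 hq.1 hq.2]
      linarith
    · have := partCube_gt hm hq
      linarith
  refine mem_extremePoints_of_lex (Or.inr ⟨l, hl, rfl⟩)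
    (planeFunctional (6 * (3 - (2 * q + 1))) 8) (planeFunctional s 0) ?_
  rintro p (rfl | ⟨m, hm, rfl⟩) hne
  · left
    have hrr : r ∈ Icc 1 r := by rw [mem_Icc]; omega
    have h3 : planeFunctional (6 * (3 - (2 * q + 1))) 8 (partPoint r l) ≤
        planeFunctional (6 * (3 - (2 * q + 1))) 8 (partPoint r r) := by
      rw [planeFunctional_partPoint, planeFunctional_partPoint]
      have := hle r hrr
      linarith
    rw [partPoint_self (by omega), map_zero] at h3
    refine h3.trans_lt ?_
    rw [planeFunctional_apply, bipartitePoint_eq (by omega)]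
    have := bipartitePoint_snd_pos hr
    simp only
    linarith
  · have hml : m ≠ l := by rintro rfl; exact hne rfl
    rw [planeFunctional_partPoint, planeFunctional_partPoint]
    by_cases hq : q * m ≤ r ∧ r ≤ (q + 1) * m
    · right
      rw [partCube_of_mem_interval (mem_Icc.1 hm).1 hq.1 hq.2,
        partCube_of_mem_interval (mem_Icc.1 hl).1 h1 h2]
      refine ⟨by ring, ?_⟩
      rw [planeFunctional_apply, planeFunctional_apply]
      have := hs m hm hml hq.1 hq.2
      linarith
    · left
      have h3 := partCube_gt hm hq
      rw [partCube_of_mem_interval (mem_Icc.1 hl).1 h1 h2]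
      linarith

theorem mem_vertexIndices : l ∈ vertexIndices r ↔
    ∃ q, 1 ≤ q ∧ q ≤ r ∧ (r / q = l ∨ r ⌈/⌉ q = l) := by
  simp only [vertexIndices, mem_union, mem_image, mem_Icc]
  constructor
  · rintro (⟨q, ⟨h1, h2⟩, h⟩ | ⟨q, ⟨h1, h2⟩, h⟩)
    · exact ⟨q, h1, h2, Or.inl h⟩
    · exact ⟨q, h1, h2, Or.inr h⟩
  · rintro ⟨q, h1, h2, h | h⟩
    · exact Or.inl ⟨q, ⟨h1, h2⟩, h⟩
    · exact Or.inr ⟨q, ⟨h1, h2⟩, h⟩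

theorem le_mul_ceilDiv (hq : 0 < q) : r ≤ q * (r ⌈/⌉ q) := (ceilDiv_le_iff_le_mul hq).1 le_rfl

theorem vertexIndices_subset (r : ℕ) : vertexIndices r ⊆ Icc 1 r := by
  intro l hl
  obtain ⟨q, h1, h2, rfl | rfl⟩ := mem_vertexIndices.1 hl
  · exact mem_Icc.2 ⟨Nat.div_pos h2 h1, Nat.div_le_self _ _⟩
  · refine mem_Icc.2 ⟨?_, (ceilDiv_le_iff_le_mul h1).2 (Nat.le_mul_of_pos_left _ h1)⟩
    rw [Nat.one_le_iff_ne_zero]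
    intro h
    have := le_mul_ceilDiv (r := r) h1
    rw [h] at this
    omega

theorem partPoint_mem_extremePoints (hr : 3 ≤ r) (hl : l ∈ vertexIndices r) :
    partPoint r l ∈ (polygon r).extremePoints ℝ := by
  have hlI := vertexIndices_subset r hl
  have hlI' := mem_Icc.1 hlI
  obtain ⟨q, hq1, hqr, rfl | h⟩ := mem_vertexIndices.1 hl
  · obtain ⟨h1, h2⟩ := div_mul_le_and_le (r := r) hlI'.1
    refine partPoint_mem_extremePoints_of hr hlI h1 h2 1 fun m hm hne hm1 _ => ?_
    have hm' := mem_Icc.1 hm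
    -- The face used has index `r / l`, possibly larger than `q`; this makes `l = r / q` its largest
    -- index.
    have hq : q ≤ r / (r / q) := (Nat.le_div_iff_mul_le hlI'.1).2 (Nat.mul_div_le r q)
    have hle : m ≤ r / q := by
      rw [Nat.le_div_iff_mul_le hq1, mul_comm]
      exact (Nat.mul_le_mul_right m hq).trans hm1
    rw [one_mul, one_mul]
    exact partPoint_fst_lt hm'.1 (lt_of_le_of_ne hle hne) hlI'.2
  · have hlpos := hlI'.1
    have hrl : 0 < r ⌈/⌉ l := by
      by_contra! h0
      have := le_mul_ceilDiv (r := r) hlpos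
      rw [Nat.le_zero.1 h0] at this
      omega
    -- The face of index `p = ⌈r/l⌉ - 1` is used, so that `l` is its smallest index.
    obtain ⟨p, hp⟩ : ∃ p, r ⌈/⌉ l = p + 1 := ⟨r ⌈/⌉ l - 1, by omega⟩
    have h2 : r ≤ (p + 1) * l := by
      have := le_mul_ceilDiv (r := r) hlpos
      rwa [hp, mul_comm] at this
    have h1 : p * l ≤ r := by
      by_contra! hlt
      have := (ceilDiv_le_iff_le_mul hlpos).2 (by rw [mul_comm]; exact hlt.le : r ≤ l * p)
      omega
    refine partPoint_mem_extremePoints_of hr hlI h1 h2 (-1) fun m hm hne _ hm2 => ?_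
    have hm' := mem_Icc.1 hm
    have hpq : p + 1 ≤ q := by
      rw [← hp, ceilDiv_le_iff_le_mul hlpos, mul_comm, ← h]
      exact le_mul_ceilDiv hq1
    have hle : l ≤ m := by
      rw [← h, ceilDiv_le_iff_le_mul hq1]
      exact hm2.trans (Nat.mul_le_mul_right m hpq)
    have := partPoint_fst_lt hlI'.1 (lt_of_le_of_ne hle hne.symm) hm'.2
    linarith

/-- An index that is neither end of its face has `l - 1` and `l + 1` on the same face; points there
are affine in `l`, so this one is a midpoint. -/
theorem partPoint_notMem_extremePoints (hl : l ∈ Icc 1 r) (hnot : l ∉ vertexIndices r) :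
    partPoint r l ∉ (polygon r).extremePoints ℝ := by
  have hl' := mem_Icc.1 hl
  have hl1 : l ≠ 1 := fun h => hnot (mem_vertexIndices.2 ⟨r, by omega, le_rfl, Or.inl (by
    rw [Nat.div_self (by omega), h])⟩)
  have hlr : l ≠ r := fun h => hnot (mem_vertexIndices.2 ⟨1, le_rfl, by omega, Or.inl (by
    rw [Nat.div_one, h])⟩)
  set q := r / l with hq
  have hqpos : 0 < q := Nat.div_pos hl'.2 hl'.1
  have hql : q * l ≤ r := (div_mul_le_and_le hl'.1).1
  have hql2 : r ≤ (q + 1) * l := (div_mul_le_and_le hl'.1).2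
  have hqr : q + 1 ≤ r := by nlinarith [show 2 ≤ l by omega]
  have h1 : q * (l + 1) ≤ r := by
    have h : r / q ≠ l := fun h => hnot (mem_vertexIndices.2 ⟨q, hqpos, by omega, Or.inl h⟩)
    have h2 : l ≤ r / q := (Nat.le_div_iff_mul_le hqpos).2 (by rw [mul_comm]; exact hql)
    have h3 : l + 1 ≤ r / q := by omega
    rw [Nat.le_div_iff_mul_le hqpos] at h3
    rw [mul_comm]; exact h3
  have h2 : r ≤ (q + 1) * (l - 1) := by
    have h : r ⌈/⌉ (q + 1) ≠ l := fun h =>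
      hnot (mem_vertexIndices.2 ⟨q + 1, by omega, hqr, Or.inr h⟩)
    have h2 : r ⌈/⌉ (q + 1) ≤ l := (ceilDiv_le_iff_le_mul (by omega)).2 hql2
    exact (ceilDiv_le_iff_le_mul (by omega)).1 (by omega : r ⌈/⌉ (q + 1) ≤ l - 1)
  have h3 : q * (l - 1) ≤ r := (Nat.mul_le_mul_left q (Nat.sub_le l 1)).trans hql
  have h4 : r ≤ (q + 1) * (l + 1) := hql2.trans (Nat.mul_le_mul_left _ (Nat.le_succ l))
  have hcast : ((l - 1 : ℕ) : ℝ) = l - 1 := by rw [Nat.cast_sub (by omega)]; simp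
  have s1 := partSq_of_mem_interval (by omega) h3 h2
  have s2 := partSq_of_mem_interval hl'.1 hql hql2
  have s3 := partSq_of_mem_interval (by omega) h1 h4
  have c1 := partCube_of_mem_interval (by omega) h3 h2
  have c2 := partCube_of_mem_interval hl'.1 hql hql2
  have c3 := partCube_of_mem_interval (by omega) h1 h4
  rw [polygon_eq]
  intro hext
  have hmem : ∀ m ∈ Icc 1 r, partPoint r m ∈ convexHull ℝ (generators r) := fun m hm =>
    subset_convexHull ℝ _ (Or.inr ⟨m, hm, rfl⟩)
  have hI1 : l - 1 ∈ Icc 1 r := by rw [mem_Icc]; omega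
  have hI2 : l + 1 ∈ Icc 1 r := by rw [mem_Icc]; omega
  have heq := (mem_extremePoints.1 hext).2 _ (hmem _ hI1) _ (hmem _ hI2)
    ⟨1 / 2, 1 / 2, by norm_num, by norm_num, by norm_num, by
      ext
      · simp only [partPoint, Prod.fst_add, Prod.smul_fst, smul_eq_mul, s1, s2, s3, hcast]
        push_cast
        ring
      · simp only [partPoint, Prod.snd_add, Prod.smul_snd, smul_eq_mul, c1, c2, c3, s1, s2, s3,
          hcast]
        push_cast
        ring⟩
  have := partPoint_injOn r hI1 hl heq.1
  omega

theorem extremePoints_polygon (hr : 3 ≤ r) : (polygon r).extremePoints ℝ =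
    insert (bipartitePoint r) (partPoint r '' (vertexIndices r : Set ℕ)) := by
  refine Set.Subset.antisymm (fun p hp => ?_) ?_
  · have hp' := hp
    rw [polygon_eq] at hp'
    rcases extremePoints_convexHull_subset hp' with rfl | ⟨l, hl, rfl⟩
    · exact Or.inl rfl
    · by_cases h : l ∈ vertexIndices r
      · exact Or.inr ⟨l, h, rfl⟩
      · exact absurd hp (partPoint_notMem_extremePoints hl h)
  · rintro p (rfl | ⟨l, hl, rfl⟩)
    · exact bipartitePoint_mem_extremePoints hr
    · exact partPoint_mem_extremePoints hr hl

theorem ncard_extremePoints_polygon (hr : 3 ≤ r) :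
    ((polygon r).extremePoints ℝ).ncard = (vertexIndices r).card + 1 := by
  have hsub := vertexIndices_subset r
  rw [extremePoints_polygon hr, Set.ncard_insert_of_notMem, Set.InjOn.ncard_image,
    Set.ncard_coe_finset]
  · exact (partPoint_injOn r).mono (coe_subset.2 hsub)
  · rintro ⟨l, hl, h⟩
    exact bipartitePoint_ne_partPoint hr (hsub hl) h.symm

theorem card_vertexIndices_le (r : ℕ) : (vertexIndices r).card ≤ r ⌈/⌉ 2 + 1 := by
  -- The divisor `q = 1` yields only `r`; every `q ≥ 2` yields at most `⌈r/2⌉`.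
  have hsub : vertexIndices r ⊆ insert r (Icc 1 (r ⌈/⌉ 2)) := by
    intro l hl
    have hl' := mem_Icc.1 (vertexIndices_subset r hl)
    obtain ⟨q, h1, h2, h⟩ := mem_vertexIndices.1 hl
    rw [mem_insert, mem_Icc]
    have h2r := le_mul_ceilDiv (r := r) (q := 2) (by norm_num)
    rcases h1.eq_or_lt with rfl | h1
    · left
      rcases h with h | h
      · rw [← h, Nat.div_one]
      · refine le_antisymm hl'.2 ?_
        have := le_mul_ceilDiv (r := r) (q := 1) (by norm_num)
        rwa [h, one_mul] at this
    · right
      refine ⟨hl'.1, ?_⟩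
      rcases h with h | h
      · rw [← h]
        refine Nat.div_le_of_le_mul (h2r.trans (Nat.mul_le_mul_right _ h1))
      · rw [← h, ceilDiv_le_iff_le_mul (by omega)]
        exact h2r.trans (Nat.mul_le_mul_right _ h1)
  refine (card_le_card hsub).trans ((card_insert_le _ _).trans ?_)
  simp

end Extreme

end CycleDensity

theorem theorem2p2 (r : ℕ) (hr : 3 ≤ r) :
    -- the graphs `C^r_l` exist, and all of them have the same point
    (∀ l ∈ Finset.Icc 1 r, ∃ p : ℝ × ℝ, CycleDensity.extremeGraphPoints r l = {p}) ∧
    -- the realizable points are exactly the rational points of the polygon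
    CycleDensity.regularPoints r =
      {p | p ∈ CycleDensity.polygon r ∧ ∃ a b : ℚ, p = ((a : ℝ), (b : ℝ))} ∧
    closure (CycleDensity.regularPoints r) = CycleDensity.polygon r ∧
    -- the vertices of the polygon, and their number
    Set.extremePoints ℝ (CycleDensity.polygon r) =
      ({CycleDensity.bipartitePoint r} ∪
        ⋃ l ∈ CycleDensity.vertexIndices r, CycleDensity.extremeGraphPoints r l) ∧
    (Set.extremePoints ℝ (CycleDensity.polygon r)).ncard =
      (CycleDensity.vertexIndices r).card + 1 ∧
    (Set.extremePoints ℝ (CycleDensity.polygon r)).ncard ≤ r ⌈/⌉ 2 + 2 := by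
  refine ⟨fun l hl => ⟨_, CycleDensity.extremeGraphPoints_eq hl⟩,
    CycleDensity.regularPoints_eq (by omega), CycleDensity.closure_regularPoints (by omega), ?_,
    CycleDensity.ncard_extremePoints_polygon hr, ?_⟩
  · rw [CycleDensity.extremePoints_polygon hr, Set.insert_eq, Set.image_eq_iUnion]
    congr 1
    exact Set.iUnion₂_congr fun l hl =>
      (CycleDensity.extremeGraphPoints_eq (CycleDensity.vertexIndices_subset r hl)).symm
  · rw [CycleDensity.ncard_extremePoints_polygon hr]
    have := CycleDensity.card_vertexIndices_le r
    omega
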